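/- Let $m\ge 2$ agents be the vertices of an undirected graph, and let $W\in\mathbb{R}^{m\times m}$ be a symmetric matrix with $W_{ij}\neq 0$ if and only if $i,j$ are adjacent or $i=j$, $0\preceq W\preceq I$, $W\mathbf 1=\mathbf 1$ and $\operatorname{null}(I-W)=\operatorname{span}(\mathbf 1)$; let $\lambda_2=\lambda_2(W)$ be its second largest eigenvalue. Let $0<\mu\le L$, let $f_1,\dots,f_m:\mathbb{R}^d\to\mathbb{R}$ be convex and $L$-smooth, let $g:\mathbb{R}^d\to\mathbb{R}$ be $\mu$-strongly convex (possibly non-smooth), put $F(x)=\frac1m\sum_{i=1}^m f_i(x)+g(x)$, and let $x^*$ be the minimizer of $F$. For matrices $\mathbf x\in\mathbb{R}^{m\times d}$ with rows $\mathbf x^{(i)}$ (the local copy of agent $i$), write $\|\cdot\|$ for the Frobenius norm, $\nabla f(\mathbf x)$ for the matrix with rows $\nabla f_i(\mathbf x^{(i)})$, and $\mathrm{prox}_{\gamma g}(\mathbf x)$ for the matrix with rows $\arg\min_w\{\gamma g(w)+\frac12\|w-\mathbf x^{(i)}\|^2\}$. Let $\eta=1/(1+\sqrt{1-\lambda_2^2})$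 and $K=\lceil 15/\sqrt{1-\lambda_2}\,\rceil$. Let $\mathrm{FastMix}(\mathbf x)$ be the procedure that puts $\mathbf x^0=\mathbf x^1=\mathbf x$, computes $\mathbf x^{k+1}=(1+\eta)W\mathbf x^k-\eta\mathbf x^{k-1}$ for $k=1,\dots,K$ (one communication round each) and returns $\mathbf x^K$. With $\gamma=\frac1{20\sqrt{L\mu}}$ and $\tau=\mu\gamma$, the algorithm ODAPG starts from $\mathbf x_1=\mathbf y_1=\mathbf z_1=\mathbf 1x_1$, $\mathbf s_1=\nabla f(\mathbf x_1)$, and iterates $$\mathbf x_{t+1}=\tau\mathbf z_t+(1-\tau)\mathbf y_t,\qquad \mathbf s_{t+1}=\mathrm{FastMix}(\mathbf s_t+\nabla f(\mathbf x_{t+1})-\nabla f(\mathbf x_t)),$$ $$\mathbf z_{t+1}=\mathrm{FastMix}(\mathrm{prox}_{\gamma g}(\mathbf z_t-\gamma\mathbf s_{t+1})),\qquad \mathbf y_{t+1}=\mathrm{FastMix}(\tau\mathbf z_{t+1}+(1-\tau)\mathbf y_t).$$ Call the iterate $\mathbf z_t$ an $\varepsilon$-suboptimal solution if $\|\mathbf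 z_t-\mathbf 1x^*\|^2\le\varepsilon$ (hence $\|\mathbf z_t^{(i)}-x^*\|^2\le\varepsilon$ for every agent $i$). Then ODAPG finds an $\varepsilon$-suboptimal solution, and all its later iterates are $\varepsilon$-suboptimal too, after $$T=\mathcal O\Big(\sqrt{\tfrac L\mu}\,\log\tfrac1\varepsilon\Big)\ \text{gradient computations per agent and}\quad C=\mathcal O\Big(\sqrt{\tfrac{L}{\mu(1-\lambda_2(W))}}\,\log\tfrac1\varepsilon\Big)\ \text{communication rounds.}$$ Here the constant in $\mathcal O$ is universal (independent of $m,d$, the network, $L,\mu$, the functions, $x_1$ and $\varepsilon$), and the bounds hold for all $\varepsilon\in(0,\varepsilon_0]$, where $\varepsilon_0>0$ may depend on the problem and on $x_1$. More precisely, for every $\varepsilon>0$ both bounds hold, with a universal constant, when $\log\frac1\varepsilon$ is replaced by $1+\log\big(1+\frac{\Delta_1}{\varepsilon}\big)$, where, with $\bar x,\bar y,\bar z,\bar s$ the row averages, $$\Delta_1=\tfrac{2m}{\mu}\big(F(\bar y_1)-F(x^*)\big)+\|\mathbf z_1-\mathbf 1x^*\|^2+\tfrac{6\cdot 20^2L}{\mu}\Big(\|\mathbf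 x_1-\mathbf 1\bar x_1\|^2+64\|\mathbf y_1-\mathbf 1\bar y_1\|^2+\tfrac{9\tau^2}{32}\|\mathbf z_1-\mathbf 1\bar z_1\|^2+\tfrac{5\tau^2}{14}\gamma^2\|\mathbf s_1-\mathbf 1\bar s_1\|^2\Big).$$ -/

import Mathlib

noncomputable section

namespace ODAPG

/-- The ambient space `ℝ^d` with its Euclidean norm. -/
abbrev Vec (d : ℕ) : Type := EuclideanSpace ℝ (Fin d)

/-- An `m × d` matrix given by its `m` rows: the local copies held by the `m` agents. -/
abbrev Rows (m d : ℕ) : Type := Fin m → Vec d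

/-! ### The objective -/

/-- `f` is convex and `L`-smooth. -/
structure IsConvexSmooth {d : ℕ} (L : ℝ) (f : Vec d → ℝ) : Prop where
  differentiable : Differentiable ℝ f
  lower : ∀ x y : Vec d, f x + inner ℝ (gradient f x) (y - x) ≤ f y
  upper : ∀ x y : Vec d,
    f y ≤ f x + inner ℝ (gradient f x) (y - x) + L / 2 * ‖x - y‖ ^ 2

/-- The composite objective `F(x) = (1/m) ∑ᵢ fᵢ(x) + g(x)`. -/
def objective {m d : ℕ} (f : Fin m → Vec d → ℝ) (g : Vec d → ℝ) (x : Vec d) : ℝ :=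
  (1 / (m : ℝ)) * ∑ i, f i x + g x

/-- `p` minimizes `w ↦ γ g(w) + ½‖w - v‖²`. -/
def IsProx {d : ℕ} (γ : ℝ) (g : Vec d → ℝ) (v p : Vec d) : Prop :=
  ∀ w : Vec d, γ * g p + 1 / 2 * ‖p - v‖ ^ 2 ≤ γ * g w + 1 / 2 * ‖w - v‖ ^ 2

/-- The proximal operator `prox_{γ g}(v) = argmin_w (γ g(w) + ½‖w - v‖²)`; for `γ ≥ 0` and
convex `g : ℝ^d → ℝ` the minimizer exists and is unique. -/
def prox {d : ℕ} (γ : ℝ) (g : Vec d → ℝ) (v : Vec d) : Vec d :=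
  Classical.epsilon (IsProx γ g v)

/-! ### The network -/

/-- `W` is a weight matrix of the network `G`: symmetric, supported exactly on the edges and the
diagonal, `0 ⪯ W ⪯ I`, `W 1 = 1`, and `null (I - W) = span 1`. -/
structure IsWeightMatrix {m : ℕ} (G : SimpleGraph (Fin m)) (W : Matrix (Fin m) (Fin m) ℝ) :
    Prop where
  isHermitian : W.IsHermitian
  support : ∀ i j, W i j ≠ 0 ↔ (G.Adj i j ∨ i = j)
  nonneg : W.PosSemidef
  le_one : (1 - W).PosSemidef
  mulVec_one : W.mulVec (fun _ => 1) = fun _ => 1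
  ker_eq : LinearMap.ker (Matrix.toLin' (1 - W)) = Submodule.span ℝ {fun _ : Fin m => (1 : ℝ)}

/-- The second largest eigenvalue of a symmetric matrix, counted with multiplicity
(`eigenvalues₀` lists the eigenvalues in decreasing order). -/
def lambda₂ {m : ℕ} {W : Matrix (Fin m) (Fin m) ℝ} (hW : W.IsHermitian) (hm : 2 ≤ m) : ℝ :=
  hW.eigenvalues₀ ⟨1, by rw [Fintype.card_fin]; exact hm⟩

/-- The matrix product `W x`: one round of communication between neighbours. -/
def gossip {m d : ℕ} (W : Matrix (Fin m) (Fin m) ℝ) (x : Rows m d) : Rows m d :=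
  fun i => ∑ j, W i j • x j

/-- The variables of FastMix after some passes through its loop: `xᵏ⁻¹`, `xᵏ`, and the number of
communication rounds used so far. -/
structure MixState (m d : ℕ) where
  prev : Rows m d
  cur : Rows m d
  rounds : ℕ

/-- One pass: `xᵏ⁺¹ = (1 + η) W xᵏ - η xᵏ⁻¹`. It uses one communication round. -/
def mixStep {m d : ℕ} (W : Matrix (Fin m) (Fin m) ℝ) (η : ℝ) (S : MixState m d) :
    MixState m d where
  prev := S.cur
  cur := (1 + η) • gossip W S.cur - η • S.prev
  rounds := S.rounds + 1

/-- The `K` passes of FastMix, started from `x⁰ = x¹ = x`. The final state holds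
`prev = xᴷ` and `cur = xᴷ⁺¹`. -/
def mixRun {m d : ℕ} (W : Matrix (Fin m) (Fin m) ℝ) (η : ℝ) (K : ℕ) (x : Rows m d) :
    MixState m d :=
  (mixStep W η)^[K] ⟨x, x, 0⟩

/-- The output `xᴷ` of FastMix. -/
def fastMix {m d : ℕ} (W : Matrix (Fin m) (Fin m) ℝ) (η : ℝ) (K : ℕ) (x : Rows m d) :
    Rows m d :=
  (mixRun W η K x).prev

/-! ### The algorithm -/

/-- The variables of the algorithm, together with the number of local gradients that each agent
has computed and the number of communication rounds. `grad` stores the last computed gradients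
`∇fᵢ(x⁽ⁱ⁾)`. -/
structure State (m d : ℕ) where
  x : Rows m d
  y : Rows m d
  z : Rows m d
  s : Rows m d
  grad : Rows m d
  gradCalls : ℕ
  rounds : ℕ

/-- Initialization: all agents start at `x₁`, and every agent computes `∇fᵢ(x₁)`. -/
def initState {m d : ℕ} (f : Fin m → Vec d → ℝ) (x₁ : Vec d) : State m d where
  x := fun _ => x₁
  y := fun _ => x₁
  z := fun _ => x₁
  s := fun i => gradient (f i) x₁
  grad := fun i => gradient (f i) x₁
  gradCalls := 1
  rounds := 0

/-- One iteration of ODAPG: one new gradient per agent and three calls of FastMix. -/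
def step {m d : ℕ} (W : Matrix (Fin m) (Fin m) ℝ) (η : ℝ) (K : ℕ) (γ τ : ℝ)
    (f : Fin m → Vec d → ℝ) (g : Vec d → ℝ) (S : State m d) : State m d :=
  let x' : Rows m d := τ • S.z + (1 - τ) • S.y
  let grad' : Rows m d := fun i => gradient (f i) (x' i)
  let sIn : Rows m d := S.s + grad' - S.grad
  let s' : Rows m d := fastMix W η K sIn
  let zIn : Rows m d := fun i => prox γ g (S.z i - γ • s' i)
  let z' : Rows m d := fastMix W η K zIn
  let yIn : Rows m d := τ • z' + (1 - τ) • S.y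
  let y' : Rows m d := fastMix W η K yIn
  { x := x'
    y := y'
    z := z'
    s := s'
    grad := grad'
    gradCalls := S.gradCalls + 1
    rounds := S.rounds + (mixRun W η K sIn).rounds + (mixRun W η K zIn).rounds
      + (mixRun W η K yIn).rounds }

/-- FastMix parameter `η = 1 / (1 + √(1 - λ₂²))`. -/
def mixWeight (lam : ℝ) : ℝ := 1 / (1 + √(1 - lam ^ 2))

/-- Number of FastMix passes, `15 / √(1 - λ₂)` rounded up. -/
def mixLength (lam : ℝ) : ℕ := ⌈15 / √(1 - lam)⌉₊

/-- Step size `γ = 1 / (20 √(L μ))`. -/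
def stepSize (L μ : ℝ) : ℝ := 1 / (20 * √(L * μ))

/-- Coupling parameter `τ = μ γ`. -/
def coupling (L μ : ℝ) : ℝ := μ * stepSize L μ

/-- The state of ODAPG after `T` iterations from `x₁`, with the constant parameters above;
`lam` stands for `λ₂(W)`. -/
def odapg {m d : ℕ} (W : Matrix (Fin m) (Fin m) ℝ) (lam L μ : ℝ)
    (f : Fin m → Vec d → ℝ) (g : Vec d → ℝ) (x₁ : Vec d) (T : ℕ) : State m d :=
  (step W (mixWeight lam) (mixLength lam) (stepSize L μ) (coupling L μ) f g)^[T] (initState f x₁)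

/-! ### Accuracy and complexity -/

/-- The average `(1/m) ∑ᵢ x⁽ⁱ⁾`. -/
def average {m d : ℕ} (x : Rows m d) : Vec d := (1 / (m : ℝ)) • ∑ i, x i

/-- `‖x - 1 v‖²` in the Frobenius norm. -/
def sqDist {m d : ℕ} (x : Rows m d) (v : Vec d) : ℝ := ∑ i, ‖x i - v‖ ^ 2

/-- `‖Π x‖² = ‖x - 1 x̄‖²`. -/
def consensusError {m d : ℕ} (x : Rows m d) : ℝ := sqDist x (average x)

/-- The quantity, depending only on the data and on the starting point, that the linear rate of
the algorithm multiplies. -/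
def initialGap {m d : ℕ} (L μ : ℝ) (f : Fin m → Vec d → ℝ) (g : Vec d → ℝ)
    (x₁ xstar : Vec d) : ℝ :=
  let S := initState f x₁
  let γ := stepSize L μ
  let τ := coupling L μ
  2 * m / μ * (objective f g (average S.y) - objective f g xstar) + sqDist S.z xstar
    + 6 * 20 ^ 2 * L / μ * (consensusError S.x + 64 * consensusError S.y
      + 9 * τ ^ 2 / 32 * consensusError S.z + 5 * τ ^ 2 / 14 * γ ^ 2 * consensusError S.s)

/-- The iterates `z` form an `ε`-suboptimal solution: `‖z - 1 x*‖² ≤ ε`, so that in particular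
`‖z⁽ⁱ⁾ - x*‖² ≤ ε` for every agent. -/
def IsSuboptimal {m d : ℕ} (xstar : Vec d) (ε : ℝ) (S : State m d) : Prop :=
  sqDist S.z xstar ≤ ε

/-- The run reaches an `ε`-suboptimal solution, and stays `ε`-suboptimal from then on, after at
most `A` gradient computations per agent and at most `B` communication rounds. -/
def FindsWithin {m d : ℕ} (run : ℕ → State m d) (xstar : Vec d) (ε A B : ℝ) : Prop :=
  ∃ T : ℕ, (∀ T' ≥ T, IsSuboptimal xstar ε (run T')) ∧
    ((run T).gradCalls : ℝ) ≤ A ∧ ((run T).rounds : ℝ) ≤ B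

end ODAPG

end

/-! FastMix preserves row averages and, with the prescribed number of passes, shrinks the squared
consensus error by a factor of 100. Hence the averages follow an accelerated proximal gradient
method whose only inexactness comes from disagreement between agents, and that disagreement is
damped faster than the method converges.

`descent` quantifies the inexact step. Besides the usual contraction it leaves three negative terms:
the displacement of the average of `z`, the disagreement of the unmixed prox outputs, and the
gradient differences between the average of `y` and the local points. These pay for all consensus
errors, including the gradient change that enters the tracker `s`. So one potential, an objective
gap plus a distance plus scaled consensus errors, falls by the factor `1 + τ` per iteration
(`potential_step_le`).

Since `1 / τ = 20 √(L / μ)`, a multiple of `√(L / μ)` times the logarithm is enough iterations, each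
costing one gradient per agent and three FastMix calls of `O(1 / √(1 - λ₂))` rounds.

The FastMix rate (`IsWeightMatrix.consensusError_fastMix_le`) comes from diagonalizing `W`: each
eigencoefficient obeys a scalar two-step recurrence with a quadratic form that is multiplied by
exactly `η` per pass. -/

namespace ODAPG

variable {m d : ℕ}

/-! ### Averages and consensus errors -/

lemma average_add (x y : Rows m d) : average (x + y) = average x + average y := by
  simp [average, Finset.sum_add_distrib]

lemma average_smul (a : ℝ) (x : Rows m d) : average (a • x) = a • average x := by
  simp only [average, Pi.smul_apply, ← Finset.smul_sum]
  rw [smul_comm]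

lemma average_sub (x y : Rows m d) : average (x - y) = average x - average y := by
  simp [average, Finset.sum_sub_distrib, smul_sub]

lemma sum_eq_smul_average (hm : 0 < m) (x : Rows m d) : ∑ i, x i = (m : ℝ) • average x := by
  have : (m : ℝ) ≠ 0 := by positivity
  rw [average, smul_smul, mul_one_div_cancel this, one_smul]

lemma average_const (hm : 0 < m) (v : Vec d) : average (fun _ : Fin m => v) = v := by
  have : (m : ℝ) ≠ 0 := by positivity
  simp only [average, Finset.sum_const, Finset.card_univ, Fintype.card_fin]
  rw [← Nat.cast_smul_eq_nsmul ℝ, smul_smul, one_div_mul_cancel this, one_smul]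

lemma sum_sub_average (hm : 0 < m) (x : Rows m d) : ∑ i, (x i - average x) = 0 := by
  rw [Finset.sum_sub_distrib, sum_eq_smul_average hm x]
  simp [← Nat.cast_smul_eq_nsmul ℝ]

/-- Mean plus covariance: the cross terms vanish because centred rows sum to zero. -/
lemma sum_inner_eq (hm : 0 < m) (s p : Rows m d) (v : Vec d) :
    ∑ i, inner ℝ (s i) (p i - v) = m * inner ℝ (average s) (average p - v)
      + ∑ i, inner ℝ (s i - average s) (p i - average p) := by
  have h : ∀ i, inner ℝ (s i) (p i - v) = inner ℝ (s i - average s) (p i - average p)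
      + inner ℝ (s i - average s) (average p - v) + inner ℝ (average s) (p i - average p)
      + inner ℝ (average s) (average p - v) := by
    intro i
    have e : p i - v = (p i - average p) + (average p - v) := by abel
    rw [e, inner_add_right]
    simp only [inner_sub_left]
    ring
  rw [Finset.sum_congr rfl fun i _ => h i]
  simp only [Finset.sum_add_distrib, ← sum_inner, ← inner_sum, sum_sub_average hm]
  simp [← Nat.cast_smul_eq_nsmul ℝ, inner_smul_left]
  ring

lemma sqDist_eq (hm : 0 < m) (x : Rows m d) (v : Vec d) :
    sqDist x v = consensusError x + m * ‖average x - v‖ ^ 2 := by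
  have h : ∀ i, ‖x i - v‖ ^ 2 = ‖x i - average x‖ ^ 2
      + 2 * inner ℝ (x i - average x) (average x - v) + ‖average x - v‖ ^ 2 := by
    intro i
    rw [← norm_add_sq_real, sub_add_sub_cancel]
  unfold consensusError sqDist
  rw [Finset.sum_congr rfl fun i _ => h i]
  simp only [Finset.sum_add_distrib, ← Finset.mul_sum, ← sum_inner, sum_sub_average hm]
  simp

lemma sqDist_nonneg (x : Rows m d) (v : Vec d) : 0 ≤ sqDist x v :=
  Finset.sum_nonneg fun _ _ => by positivity

lemma consensusError_nonneg (x : Rows m d) : 0 ≤ consensusError x := sqDist_nonneg _ _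

lemma consensusError_le (hm : 0 < m) (x : Rows m d) (v : Vec d) :
    consensusError x ≤ sqDist x v := by
  rw [sqDist_eq hm x v]
  have : 0 ≤ (m : ℝ) * ‖average x - v‖ ^ 2 := by positivity
  linarith

lemma consensusError_smul (a : ℝ) (x : Rows m d) :
    consensusError (a • x) = a ^ 2 * consensusError x := by
  unfold consensusError sqDist
  rw [average_smul, Finset.mul_sum]
  refine Finset.sum_congr rfl fun i _ => ?_
  rw [Pi.smul_apply, ← smul_sub, norm_smul, mul_pow, Real.norm_eq_abs, sq_abs]

lemma norm_add_sq_le_two {E : Type*} [SeminormedAddCommGroup E] (a b : E) :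
    ‖a + b‖ ^ 2 ≤ 2 * ‖a‖ ^ 2 + 2 * ‖b‖ ^ 2 := by
  have := norm_add_le a b
  nlinarith [norm_nonneg (a + b), sq_nonneg (‖a‖ - ‖b‖)]

lemma norm_add_sq_le_three {E : Type*} [SeminormedAddCommGroup E] (a b c : E) :
    ‖a + b + c‖ ^ 2 ≤ 3 * (‖a‖ ^ 2 + ‖b‖ ^ 2 + ‖c‖ ^ 2) := by
  have := norm_add₃_le (a := a) (b := b) (c := c)
  nlinarith [norm_nonneg (a + b + c), sq_nonneg (‖a‖ - ‖b‖), sq_nonneg (‖a‖ - ‖c‖),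
    sq_nonneg (‖b‖ - ‖c‖)]

lemma consensusError_add_le (x y : Rows m d) :
    consensusError (x + y) ≤ 2 * consensusError x + 2 * consensusError y := by
  unfold consensusError sqDist
  rw [average_add, Finset.mul_sum, Finset.mul_sum, ← Finset.sum_add_distrib]
  refine Finset.sum_le_sum fun i _ => ?_
  rw [Pi.add_apply, add_sub_add_comm]
  exact norm_add_sq_le_two _ _

lemma consensusError_add_add_le (x y z : Rows m d) :
    consensusError (x + y + z)
      ≤ 3 * (consensusError x + consensusError y + consensusError z) := by
  unfold consensusError sqDist
  rw [average_add, average_add, ← Finset.sum_add_distrib, ← Finset.sum_add_distrib,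
    Finset.mul_sum]
  refine Finset.sum_le_sum fun i _ => ?_
  rw [Pi.add_apply, Pi.add_apply, add_sub_add_comm, add_sub_add_comm]
  exact norm_add_sq_le_three _ _ _

lemma mul_norm_average_sub_sq_le (hm : 0 < m) (x y : Rows m d) :
    m * ‖average x - average y‖ ^ 2 ≤ ∑ i, ‖x i - y i‖ ^ 2 := by
  have h := sqDist_eq hm (x - y) 0
  have h0 := consensusError_nonneg (x - y)
  rw [average_sub, sub_zero] at h
  simp only [sqDist, sub_zero, Pi.sub_apply] at h
  linarith

lemma mul_apply_average_le (hm : 0 < m) {g : Vec d → ℝ} (hg : ConvexOn ℝ Set.univ g)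
    (p : Rows m d) : m * g (average p) ≤ ∑ i, g (p i) := by
  have hm' : (0 : ℝ) < m := by exact_mod_cast hm
  have h := hg.map_sum_le (t := Finset.univ) (w := fun _ : Fin m => 1 / (m : ℝ)) (p := p)
    (fun _ _ => by positivity) (by simp [hm'.ne']) (fun _ _ => Set.mem_univ _)
  rw [← Finset.smul_sum, ← Finset.smul_sum, smul_eq_mul] at h
  calc (m : ℝ) * g (average p) ≤ m * (1 / m * ∑ i, g (p i)) := by
        unfold average; gcongr
    _ = _ := by field_simp

/-! ### Smooth convex functions and the proximal step -/

lemma IsConvexSmooth.add_norm_gradient_sub_sq_le {L : ℝ} (hL : 0 < L) {f : Vec d → ℝ}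
    (hf : IsConvexSmooth L f) (x y : Vec d) :
    f x + inner ℝ (gradient f x) (y - x) + 1 / (2 * L) * ‖gradient f y - gradient f x‖ ^ 2
      ≤ f y := by
  set e := gradient f y - gradient f x with he
  -- The lower bound from `x` and the upper bound from `y` are compared at one gradient step from
  -- `y` for `f` minus its linearization at `x`.
  have h1 := hf.lower x (y - (1 / L) • e)
  have h2 := hf.upper y (y - (1 / L) • e)
  have e1 : y - (1 / L) • e - x = (y - x) - (1 / L) • e := by abel
  have e2 : y - (1 / L) • e - y = -((1 / L) • e) := by abel
  have e3 : y - (y - (1 / L) • e) = (1 / L) • e := by abel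
  rw [e1, inner_sub_right, inner_smul_right] at h1
  rw [e2, e3, inner_neg_right, inner_smul_right, norm_smul, mul_pow, Real.norm_eq_abs, sq_abs] at h2
  have h3 : inner ℝ (gradient f y) e - inner ℝ (gradient f x) e = ‖e‖ ^ 2 := by
    rw [← inner_sub_left, ← he, real_inner_self_eq_norm_sq]
  have h4 : L / 2 * ((1 / L) ^ 2 * ‖e‖ ^ 2) = 1 / (2 * L) * ‖e‖ ^ 2 := by field_simp
  have h5 : 1 / L * ‖e‖ ^ 2 = 2 * (1 / (2 * L) * ‖e‖ ^ 2) := by field_simp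
  rw [h4] at h2
  rw [← h3, mul_sub, h3] at h5
  linarith

lemma IsConvexSmooth.norm_gradient_sub_sq_le {L : ℝ} (hL : 0 < L) {f : Vec d → ℝ}
    (hf : IsConvexSmooth L f) (x y : Vec d) :
    ‖gradient f y - gradient f x‖ ^ 2 ≤ L ^ 2 * ‖y - x‖ ^ 2 := by
  have h1 := hf.add_norm_gradient_sub_sq_le hL x y
  have h2 := hf.upper x y
  have h3 : 1 / (2 * L) * ‖gradient f y - gradient f x‖ ^ 2 ≤ L / 2 * ‖y - x‖ ^ 2 := by
    rw [norm_sub_rev y x]; linarith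
  have h4 := mul_le_mul_of_nonneg_left h3 (by positivity : 0 ≤ 2 * L)
  have e1 : 2 * L * (1 / (2 * L) * ‖gradient f y - gradient f x‖ ^ 2)
      = ‖gradient f y - gradient f x‖ ^ 2 := by field_simp
  rw [e1] at h4
  linarith

/-- Compare `p` with the point `s • w + (1 - s) • p`, divide by `s`, and let `s` tend to `0`. -/
lemma StrongConvexOn.add_norm_sub_sq_le_of_isMin {κ : ℝ} {h : Vec d → ℝ}
    (hh : StrongConvexOn Set.univ κ h) {p : Vec d} (hp : ∀ w, h p ≤ h w) (w : Vec d) :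
    h p + κ / 2 * ‖w - p‖ ^ 2 ≤ h w := by
  have key : ∀ s ∈ Set.Ioo (0 : ℝ) 1, h p + (1 - s) * (κ / 2 * ‖w - p‖ ^ 2) ≤ h w := by
    rintro s ⟨hs0, hs1⟩
    have h1 := hh.2 (Set.mem_univ w) (Set.mem_univ p) hs0.le (sub_nonneg.2 hs1.le) (by ring)
    have h2 := (hp _).trans h1
    simp only [smul_eq_mul] at h2
    have h3 : s * (h p + (1 - s) * (κ / 2 * ‖w - p‖ ^ 2)) ≤ s * h w := by linarith
    exact le_of_mul_le_mul_left h3 hs0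
  have hc : Filter.Tendsto (fun s : ℝ => h p + (1 - s) * (κ / 2 * ‖w - p‖ ^ 2))
      (nhdsWithin 0 (Set.Ioi 0)) (nhds (h p + (1 - 0) * (κ / 2 * ‖w - p‖ ^ 2))) := by
    refine Filter.Tendsto.mono_left (Continuous.tendsto (by fun_prop) 0) nhdsWithin_le_nhds
  have := le_of_tendsto hc (Filter.eventually_of_mem (Ioo_mem_nhdsGT one_pos) key)
  simpa using this

lemma StrongConvexOn.exists_isMin {κ : ℝ} (hκ : 0 < κ) {h : Vec d → ℝ}
    (hh : StrongConvexOn Set.univ κ h) : ∃ p, ∀ w, h p ≤ h w := by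
  have hconv : ConvexOn ℝ Set.univ h := hh.convexOn fun r => by positivity
  have hcont : Continuous h := by
    rw [← continuousOn_univ]
    exact hconv.continuousOn isOpen_univ
  obtain ⟨q, -, hq⟩ := (isCompact_closedBall (0 : Vec d) 1).exists_isMinOn
    ⟨0, by simp⟩ hcont.continuousOn
  -- Beyond this radius, strong convexity on the segment from `0` to `w`, with the value on the unit
  -- sphere bounded below by `h q`, forces `h 0 ≤ h w`. A minimizer over the ball is therefore
  -- global.
  set R : ℝ := 1 + 2 * (h 0 - h q) / κ with hR
  have hq0 : h q ≤ h 0 := hq (by simp)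
  have hR1 : 1 ≤ R := by
    have : 0 ≤ 2 * (h 0 - h q) / κ := by apply div_nonneg _ hκ.le; linarith
    linarith
  obtain ⟨p, -, hp⟩ := (isCompact_closedBall (0 : Vec d) R).exists_isMinOn
    ⟨0, by simpa using by linarith⟩ hcont.continuousOn
  refine ⟨p, fun w => ?_⟩
  by_cases hw : ‖w‖ ≤ R
  · exact hp (by simpa using hw)
  · push Not at hw
    have hp0 : h p ≤ h 0 := hp (by simpa using by linarith)
    have hw1 : 1 < ‖w‖ := by linarith
    have hw0 : 0 < ‖w‖ := by linarith
    have hi : ‖w‖⁻¹ * ‖w‖ = 1 := inv_mul_cancel₀ hw0.ne'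
    have h1 := hh.2 (Set.mem_univ w) (Set.mem_univ (0 : Vec d)) (inv_nonneg.2 hw0.le)
      (sub_nonneg.2 (inv_le_one_of_one_le₀ hw1.le)) (by ring)
    have h2 : h q ≤ h (‖w‖⁻¹ • w + (1 - ‖w‖⁻¹) • (0 : Vec d)) := by
      apply hq
      simp [norm_smul, hi]
    have h3 := h2.trans h1
    simp only [smul_eq_mul, sub_zero] at h3
    have h4 := mul_le_mul_of_nonneg_left h3 hw0.le
    have e : ‖w‖ * (‖w‖⁻¹ * h w + (1 - ‖w‖⁻¹) * h 0 -
        ‖w‖⁻¹ * (1 - ‖w‖⁻¹) * (κ / 2 * ‖w‖ ^ 2))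
        = h w + (‖w‖ - 1) * h 0 - (‖w‖ - 1) * (κ / 2 * ‖w‖) := by
      field_simp
    rw [e] at h4
    have h5 : κ * (‖w‖ - 1) ≥ 2 * (h 0 - h q) := by
      have : 2 * (h 0 - h q) / κ ≤ ‖w‖ - 1 := by linarith
      rw [div_le_iff₀ hκ] at this
      linarith
    have h6 : ‖w‖ * (κ * (‖w‖ - 1)) ≥ ‖w‖ * (2 * (h 0 - h q)) :=
      mul_le_mul_of_nonneg_left h5 hw0.le
    linarith

lemma strongConvexOn_prox_objective {γ μ : ℝ} (hγ : 0 ≤ γ) {g : Vec d → ℝ}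
    (hg : StrongConvexOn Set.univ μ g) (v : Vec d) :
    StrongConvexOn Set.univ (1 + μ * γ) (fun w => γ * g w + 1 / 2 * ‖w - v‖ ^ 2) := by
  refine ⟨convex_univ, fun x _ y _ a b ha hb hab => ?_⟩
  have h1 := mul_le_mul_of_nonneg_left (hg.2 (Set.mem_univ x) (Set.mem_univ y) ha hb hab) hγ
  have h2 : ‖a • x + b • y - v‖ ^ 2
      = a * ‖x - v‖ ^ 2 + b * ‖y - v‖ ^ 2 - a * b * ‖x - y‖ ^ 2 := by
    have e1 : a • x + b • y - v = a • (x - v) + b • (y - v) := by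
      have : v = (a + b) • v := by rw [hab, one_smul]
      nth_rw 1 [this]
      module
    have e2 : x - y = (x - v) - (y - v) := by abel
    obtain rfl : b = 1 - a := by linarith
    rw [e1, e2, norm_add_sq_real, norm_sub_sq_real (x - v) (y - v), norm_smul, norm_smul, inner_smul_left,
      inner_smul_right, mul_pow, mul_pow, Real.norm_eq_abs, Real.norm_eq_abs, sq_abs, sq_abs]
    simp only [conj_trivial]
    ring
  simp only [smul_eq_mul] at h1 ⊢
  rw [h2]
  linarith

/-- `prox` is defined by choice; strong convexity supplies the minimizer that makes the choice
meaningful. -/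
lemma isProx_prox {γ μ : ℝ} (hγ : 0 ≤ γ) (hμ : 0 ≤ μ) {g : Vec d → ℝ}
    (hg : StrongConvexOn Set.univ μ g) (v : Vec d) : IsProx γ g v (prox γ g v) := by
  refine Classical.epsilon_spec (p := IsProx γ g v) ?_
  exact StrongConvexOn.exists_isMin (by positivity) (strongConvexOn_prox_objective hγ hg v)

/-- Quadratic growth at the minimizer with the squares expanded. The modulus `1 + μ * γ` is the
source of the linear rate. -/
lemma IsProx.le {γ μ : ℝ} (hγ : 0 ≤ γ) {g : Vec d → ℝ}
    (hg : StrongConvexOn Set.univ μ g) {z s p : Vec d} (hp : IsProx γ g (z - γ • s) p)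
    (w : Vec d) :
    2 * γ * (g p - g w) + 2 * γ * inner ℝ s (p - w) + (1 + μ * γ) * ‖p - w‖ ^ 2
      ≤ ‖z - w‖ ^ 2 - ‖p - z‖ ^ 2 := by
  have h := StrongConvexOn.add_norm_sub_sq_le_of_isMin
    (strongConvexOn_prox_objective hγ hg (z - γ • s)) hp w
  have e : ∀ q : Vec d, ‖q - (z - γ • s)‖ ^ 2
      = ‖q - z‖ ^ 2 + 2 * (γ * inner ℝ s (q - z)) + ‖γ • s‖ ^ 2 := by
    intro q
    rw [show q - (z - γ • s) = (q - z) + γ • s by abel, norm_add_sq_real, inner_smul_right,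
      real_inner_comm]
  have e2 : inner ℝ s (p - w) = inner ℝ s (p - z) - inner ℝ s (w - z) := by
    rw [← inner_sub_right, sub_sub_sub_cancel_right]
  simp only [e] at h
  rw [e2, norm_sub_rev p w, norm_sub_rev z w]
  linarith

/-! ### FastMix: averages and eigencoefficients -/

section Gossip

variable {W : Matrix (Fin m) (Fin m) ℝ}

lemma fastMix_zero (η : ℝ) (x : Rows m d) : fastMix W η 0 x = x := rfl

lemma fastMix_add_two (η : ℝ) (k : ℕ) (x : Rows m d) :
    fastMix W η (k + 2) x
      = (1 + η) • gossip W (fastMix W η (k + 1) x) - η • fastMix W η k x := by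
  simp only [fastMix, mixRun, Function.iterate_succ_apply']
  rfl

lemma rounds_mixRun (η : ℝ) (K : ℕ) (x : Rows m d) : (mixRun W η K x).rounds = K := by
  induction K with
  | zero => rfl
  | succ k ih =>
    rw [mixRun, Function.iterate_succ_apply'] at *
    simpa [mixStep] using ih

lemma gossip_sub (x y : Rows m d) : gossip W (x - y) = gossip W x - gossip W y := by
  ext1 i
  simp [gossip, smul_sub, Finset.sum_sub_distrib]

lemma IsWeightMatrix.sum_row {G : SimpleGraph (Fin m)} (hW : IsWeightMatrix G W) (i : Fin m) :
    ∑ j, W i j = 1 := by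
  have := congrFun hW.mulVec_one i
  simpa [Matrix.mulVec, dotProduct] using this

lemma IsWeightMatrix.symm {G : SimpleGraph (Fin m)} (hW : IsWeightMatrix G W) (i j : Fin m) :
    W i j = W j i := by
  simpa using (hW.isHermitian.apply i j).symm

lemma IsWeightMatrix.average_gossip {G : SimpleGraph (Fin m)} (hW : IsWeightMatrix G W)
    (x : Rows m d) : average (gossip W x) = average x := by
  unfold average gossip
  rw [Finset.sum_comm]
  simp_rw [← Finset.sum_smul]
  congr 1
  refine Finset.sum_congr rfl fun j _ => ?_
  rw [Finset.sum_congr rfl fun i _ => hW.symm i j, hW.sum_row, one_smul]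

lemma IsWeightMatrix.gossip_const {G : SimpleGraph (Fin m)} (hW : IsWeightMatrix G W)
    (v : Vec d) : gossip W (fun _ => v) = fun _ => v := by
  ext1 i
  simp only [gossip]
  rw [← Finset.sum_smul, hW.sum_row, one_smul]

lemma IsWeightMatrix.average_fastMix {G : SimpleGraph (Fin m)} (hW : IsWeightMatrix G W)
    (η : ℝ) (K : ℕ) (x : Rows m d) : average (fastMix W η K x) = average x := by
  induction K using Nat.twoStepInduction with
  | zero => rfl
  | one => rfl
  | more k h1 h2 =>
    rw [fastMix_add_two, average_sub, average_smul, average_smul, hW.average_gossip, h1, h2]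
    module

/-- The coefficient of the columns of `x` along the vector `b`. -/
def coef (b : EuclideanSpace ℝ (Fin m)) (x : Rows m d) : Vec d := ∑ j, b j • x j

lemma coef_sub (b : EuclideanSpace ℝ (Fin m)) (x y : Rows m d) :
    coef b (x - y) = coef b x - coef b y := by
  simp [coef, smul_sub, Finset.sum_sub_distrib]

lemma coef_smul (b : EuclideanSpace ℝ (Fin m)) (a : ℝ) (x : Rows m d) :
    coef b (a • x) = a • coef b x := by
  simp only [coef, Pi.smul_apply, Finset.smul_sum]
  exact Finset.sum_congr rfl fun j _ => smul_comm _ _ _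

/-- Parseval, applied to each of the `d` columns separately. -/
lemma sum_norm_coef_sq (b : OrthonormalBasis (Fin m) ℝ (EuclideanSpace ℝ (Fin m)))
    (x : Rows m d) : ∑ i, ‖coef (b i) x‖ ^ 2 = ∑ j, ‖x j‖ ^ 2 := by
  have h : ∀ i c, (coef (b i) x) c
      = inner ℝ (b i) (WithLp.toLp 2 (fun j => x j c) : EuclideanSpace ℝ (Fin m)) := by
    intro i c
    simp [coef, PiLp.inner_apply, mul_comm]
  simp only [EuclideanSpace.norm_sq_eq, h]
  rw [Finset.sum_comm]
  simp only [b.sum_sq_norm_inner_right, EuclideanSpace.norm_sq_eq]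
  rw [Finset.sum_comm]

lemma coef_gossip {b : EuclideanSpace ℝ (Fin m)} {lam : ℝ}
    (hs : ∀ i j, W i j = W j i) (hb : ∀ k, ∑ j, W k j * b j = lam * b k) (x : Rows m d) :
    coef b (gossip W x) = lam • coef b x := by
  simp only [coef, gossip, Finset.smul_sum, smul_smul]
  rw [Finset.sum_comm]
  refine Finset.sum_congr rfl fun k _ => ?_
  rw [← Finset.sum_smul, ← hb k]
  congr 1
  exact Finset.sum_congr rfl fun j _ => by rw [hs j k, mul_comm]

end Gossip

/-! ### The momentum recurrence and its rate -/

lemma norm_sq_le_of_two_step_recurrence {E : Type*} [NormedAddCommGroup E]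
    [InnerProductSpace ℝ E] {a η : ℝ} {u : ℕ → E} (h01 : u 1 = u 0)
    (hu : ∀ k, u (k + 2) = a • u (k + 1) - η • u k) (K : ℕ) :
    (η - a ^ 2 / 4) * ‖u K‖ ^ 2 ≤ η ^ K * ((1 + η - a) * ‖u 0‖ ^ 2) := by
  -- This quadratic form in two consecutive terms is multiplied by exactly `η` at each step;
  -- completing the square bounds it below by `(η - a ^ 2 / 4) * ‖u k‖ ^ 2`.
  have key : ∀ k, ‖u (k + 1)‖ ^ 2 - a * inner ℝ (u (k + 1)) (u k) + η * ‖u k‖ ^ 2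
      = η ^ k * ((1 + η - a) * ‖u 0‖ ^ 2) := by
    intro k
    induction k with
    | zero =>
      rw [h01, real_inner_self_eq_norm_sq]
      ring
    | succ k ih =>
      have hk : u (k + 1 + 1) = a • u (k + 1) - η • u k := hu k
      rw [pow_succ' η k, mul_assoc, ← ih, hk, norm_sub_sq_real, inner_sub_left, inner_smul_left,
        inner_smul_left, inner_smul_left, inner_smul_right, norm_smul, norm_smul, mul_pow, mul_pow,
        Real.norm_eq_abs, Real.norm_eq_abs, sq_abs, sq_abs, real_inner_self_eq_norm_sq,
        real_inner_comm (u (k + 1)) (u k)]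
      simp only [conj_trivial]
      ring
  rw [← key K]
  have h := sq_nonneg ‖u (K + 1) - (a / 2) • u K‖
  rw [norm_sub_sq_real, inner_smul_right, norm_smul, mul_pow, Real.norm_eq_abs, sq_abs] at h
  linarith

/-- With `s = √(1 - λ₂²)`, every eigenvalue in `[0, λ₂]` gives complex characteristic roots, so the
quadratic form is definite. Its initial value exceeds the lower bound by at most a factor 4,
uniformly: both sides carry a factor `1 - lam`, which cancels as the spectral gap closes. -/
lemma mixWeight_ratio {s lam : ℝ} (hs0 : 0 < s) (hl0 : 0 ≤ lam)
    (hl1 : lam < 1) (hls : lam ^ 2 ≤ 1 - s ^ 2) :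
    0 < 1 / (1 + s) - ((1 + 1 / (1 + s)) * lam) ^ 2 / 4 ∧
    1 + 1 / (1 + s) - (1 + 1 / (1 + s)) * lam
      ≤ 4 * (1 / (1 + s) - ((1 + 1 / (1 + s)) * lam) ^ 2 / 4) := by
  have h1 : (1 + s) * (2 + s) * (1 - lam) ≤ 4 * (1 + s) - (2 + s) ^ 2 * lam ^ 2 := by
    have e : 4 * (1 + s) - (2 + s) ^ 2 * lam ^ 2
        = 4 * (1 + s) * (1 - lam ^ 2) - s ^ 2 * lam ^ 2 := by ring
    have h2 : s ^ 2 * lam ^ 2 ≤ (1 - lam ^ 2) * lam ^ 2 := by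
      apply mul_le_mul_of_nonneg_right _ (sq_nonneg _)
      linarith
    have h3 : (1 + s) * (2 + s) ≤ (1 + lam) * (4 * (1 + s) - lam ^ 2) := by nlinarith
    have h4 := mul_le_mul_of_nonneg_right h3 (sub_nonneg.2 hl1.le)
    rw [e]
    linarith
  have h0 : 0 < (1 + s) * (2 + s) * (1 - lam) := by
    have := sub_pos.2 hl1
    positivity
  have hp : 0 < 1 + s := by linarith
  have e1 : 1 / (1 + s) - ((1 + 1 / (1 + s)) * lam) ^ 2 / 4
      = (4 * (1 + s) - (2 + s) ^ 2 * lam ^ 2) / (4 * (1 + s) ^ 2) := by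
    field_simp
    ring
  have e2 : 1 + 1 / (1 + s) - (1 + 1 / (1 + s)) * lam
      = 4 * ((1 + s) * (2 + s) * (1 - lam)) / (4 * (1 + s) ^ 2) := by
    field_simp
    ring
  rw [e1, e2, mul_div_assoc']
  refine ⟨div_pos (by linarith) (by positivity), ?_⟩
  gcongr

/-- Bernoulli gives `(1 + s) ^ (1 / s) ≥ 2`, and the number of passes is at least `15 / s` because
`1 - lam ≤ 1 - lam ^ 2`. -/
lemma mixWeight_pow_mixLength_le {lam : ℝ} (h0 : 0 ≤ lam) (h1 : lam < 1) :
    mixWeight lam ^ mixLength lam ≤ 1 / 2 ^ 15 := by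
  have hs : 0 < √(1 - lam ^ 2) := Real.sqrt_pos.2 (by nlinarith)
  have hs1 : √(1 - lam ^ 2) ≤ 1 := Real.sqrt_le_one.2 (by nlinarith)
  have hr : 0 < √(1 - lam) := Real.sqrt_pos.2 (by linarith)
  have hrs : √(1 - lam) ≤ √(1 - lam ^ 2) := Real.sqrt_le_sqrt (by nlinarith)
  rw [mixWeight, div_pow, one_pow]
  apply one_div_le_one_div_of_le (by positivity)
  set s := √(1 - lam ^ 2)
  have hK : 1 / s * 15 ≤ (mixLength lam : ℝ) := by
    refine le_trans ?_ (Nat.le_ceil _)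
    rw [one_div_mul_eq_div]
    gcongr
  have hB : 2 ≤ (1 + s) ^ (1 / s) := by
    have := one_add_mul_self_le_rpow_one_add (s := s) (by linarith) (p := 1 / s)
      (by rw [le_div_iff₀ hs]; linarith)
    rw [one_div_mul_cancel hs.ne'] at this
    linarith
  calc (2 : ℝ) ^ 15 ≤ ((1 + s) ^ (1 / s)) ^ 15 := by gcongr
    _ = (1 + s) ^ (1 / s * 15) := by
        rw [Real.rpow_mul (by linarith)]; norm_cast
    _ ≤ (1 + s) ^ (mixLength lam : ℝ) := Real.rpow_le_rpow_of_exponent_le (by linarith) hK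
    _ = _ := Real.rpow_natCast _ _

/-! ### Spectrum of the weight matrix and contraction of FastMix -/

section Spectrum

variable {G : SimpleGraph (Fin m)} {W : Matrix (Fin m) (Fin m) ℝ}

lemma IsWeightMatrix.sum_mul_eigenvectorBasis (hW : IsWeightMatrix G W) (i k : Fin m) :
    ∑ j, W k j * hW.isHermitian.eigenvectorBasis i j
      = hW.isHermitian.eigenvalues i * hW.isHermitian.eigenvectorBasis i k := by
  have := congrFun (hW.isHermitian.mulVec_eigenvectorBasis i) k
  simpa [Matrix.mulVec, dotProduct] using this

lemma IsWeightMatrix.eigenvalues_nonneg (hW : IsWeightMatrix G W) (i : Fin m) :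
    0 ≤ hW.isHermitian.eigenvalues i :=
  hW.nonneg.eigenvalues_nonneg i

lemma IsWeightMatrix.eigenvalues_le_one (hW : IsWeightMatrix G W) (i : Fin m) :
    hW.isHermitian.eigenvalues i ≤ 1 := by
  have h := hW.le_one.dotProduct_mulVec_nonneg (hW.isHermitian.eigenvectorBasis i).ofLp
  rw [Matrix.sub_mulVec, hW.isHermitian.mulVec_eigenvectorBasis, Matrix.one_mulVec,
    dotProduct_sub, dotProduct_smul] at h
  have h1 : star (hW.isHermitian.eigenvectorBasis i).ofLp
      ⬝ᵥ (hW.isHermitian.eigenvectorBasis i).ofLp = 1 := by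
    have := hW.isHermitian.eigenvectorBasis.orthonormal.1 i
    have h2 : inner ℝ (hW.isHermitian.eigenvectorBasis i) (hW.isHermitian.eigenvectorBasis i)
        = (1 : ℝ) := by rw [real_inner_self_eq_norm_sq, this, one_pow]
    rw [← h2, EuclideanSpace.inner_eq_star_dotProduct, dotProduct_comm]
  rw [h1] at h
  simpa using h

lemma IsWeightMatrix.eigenvectorBasis_const (hW : IsWeightMatrix G W) {i : Fin m}
    (hi : hW.isHermitian.eigenvalues i = 1) :
    ∃ κ : ℝ, ∀ j, hW.isHermitian.eigenvectorBasis i j = κ := by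
  have h : (hW.isHermitian.eigenvectorBasis i).ofLp
      ∈ LinearMap.ker (Matrix.toLin' (1 - W)) := by
    rw [LinearMap.mem_ker, Matrix.toLin'_apply, Matrix.sub_mulVec,
      hW.isHermitian.mulVec_eigenvectorBasis, hi]
    simp
  rw [hW.ker_eq, Submodule.mem_span_singleton] at h
  obtain ⟨κ, hκ⟩ := h
  exact ⟨κ, fun j => by simp [← hκ]⟩

lemma IsWeightMatrix.exists_eigenvalues_eq_one (hW : IsWeightMatrix G W) (hm : 0 < m) :
    ∃ i, hW.isHermitian.eigenvalues i = 1 := by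
  have : (1 : ℝ) ∈ spectrum ℝ W := by
    rw [spectrum.mem_iff, Matrix.isUnit_iff_isUnit_det, isUnit_iff_ne_zero, not_not,
      ← Matrix.exists_mulVec_eq_zero_iff]
    refine ⟨fun _ => 1, fun h => ?_, ?_⟩
    · simpa using congrFun h ⟨0, hm⟩
    · rw [map_one, Matrix.sub_mulVec, hW.mulVec_one, Matrix.one_mulVec, sub_self]
  rw [hW.isHermitian.spectrum_real_eq_range_eigenvalues] at this
  exact this

lemma IsWeightMatrix.eigenvalues_eq_one_or_le (hW : IsWeightMatrix G W) (hm : 2 ≤ m)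
    (i : Fin m) :
    hW.isHermitian.eigenvalues i = 1
      ∨ hW.isHermitian.eigenvalues i ≤ lambda₂ hW.isHermitian hm := by
  obtain ⟨j, hj⟩ := hW.exists_eigenvalues_eq_one (by omega)
  have hi := hW.eigenvalues_le_one i
  unfold lambda₂
  unfold Matrix.IsHermitian.eigenvalues at *
  set e := (Fintype.equivOfCardEq (Fintype.card_fin (Fintype.card (Fin m)))).symm with he
  by_cases h : (e i : ℕ) = 0
  · left
    refine le_antisymm hi ?_
    rw [← hj]
    exact hW.isHermitian.eigenvalues₀_antitone (Fin.le_def.2 (by omega))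
  · right
    exact hW.isHermitian.eigenvalues₀_antitone (Fin.le_def.2 (by simp; omega))

lemma IsWeightMatrix.lambda₂_eq (hW : IsWeightMatrix G W) (hm : 2 ≤ m) :
    ∃ i, (∃ j, j ≠ i ∧ hW.isHermitian.eigenvalues j = 1) ∧
      lambda₂ hW.isHermitian hm = hW.isHermitian.eigenvalues i := by
  obtain ⟨j, hj⟩ := hW.exists_eigenvalues_eq_one (by omega)
  have hle := hW.eigenvalues_le_one
  unfold lambda₂
  unfold Matrix.IsHermitian.eigenvalues at *
  set e := (Fintype.equivOfCardEq (Fintype.card_fin (Fintype.card (Fin m)))).symm with he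
  have hc : Fintype.card (Fin m) = m := Fintype.card_fin m
  refine ⟨e.symm ⟨1, by omega⟩, ⟨e.symm ⟨0, by omega⟩, ?_, ?_⟩, by simp⟩
  · simp
  · refine le_antisymm (hle _) ?_
    rw [← hj]
    exact hW.isHermitian.eigenvalues₀_antitone (Fin.le_def.2 (by simp))

lemma IsWeightMatrix.lambda₂_nonneg (hW : IsWeightMatrix G W) (hm : 2 ≤ m) :
    0 ≤ lambda₂ hW.isHermitian hm := by
  obtain ⟨i, -, h⟩ := hW.lambda₂_eq hm
  exact h ▸ hW.eigenvalues_nonneg i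

/-- Otherwise two orthonormal eigenvectors would both be constant vectors. -/
lemma IsWeightMatrix.lambda₂_lt_one (hW : IsWeightMatrix G W) (hm : 2 ≤ m) :
    lambda₂ hW.isHermitian hm < 1 := by
  obtain ⟨i, ⟨j, hji, hj⟩, h⟩ := hW.lambda₂_eq hm
  rw [h]
  refine lt_of_le_of_ne (hW.eigenvalues_le_one i) fun hi => ?_
  obtain ⟨κ, hκ⟩ := hW.eigenvectorBasis_const hi
  obtain ⟨κ', hκ'⟩ := hW.eigenvectorBasis_const hj
  have o := hW.isHermitian.eigenvectorBasis.orthonormal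
  have h0 := o.2 hji
  have h1 := o.1 i
  have h2 := o.1 j
  have hm' : (m : ℝ) ≠ 0 := by positivity
  simp only [PiLp.inner_apply, hκ, hκ'] at h0
  rw [EuclideanSpace.norm_eq] at h1 h2
  simp only [hκ, hκ'] at h1 h2
  have h3 : κ = 0 ∨ κ' = 0 := by simpa [hm'] using h0
  rcases h3 with rfl | rfl
  · simp at h1
  · simp at h2

theorem IsWeightMatrix.consensusError_fastMix_le (hW : IsWeightMatrix G W) (hm : 2 ≤ m)
    (x : Rows m d) :
    consensusError (fastMix W (mixWeight (lambda₂ hW.isHermitian hm))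
      (mixLength (lambda₂ hW.isHermitian hm)) x) ≤ 1 / 100 * consensusError x := by
  have hm0 : 0 < m := by omega
  have hl0 := hW.lambda₂_nonneg hm
  have hl1 := hW.lambda₂_lt_one hm
  have hcase := hW.eigenvalues_eq_one_or_le hm
  set lam := lambda₂ hW.isHermitian hm
  have hpow := mixWeight_pow_mixLength_le hl0 hl1
  set η := mixWeight lam with hη
  set K := mixLength lam
  set b := hW.isHermitian.eigenvectorBasis with hb
  set u : ℕ → Rows m d := fun k => fastMix W η k x - fun _ => average x with hu
  have hrec : ∀ k, u (k + 2) = (1 + η) • gossip W (u (k + 1)) - η • u k := by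
    intro k
    simp only [hu, fastMix_add_two, gossip_sub, hW.gossip_const]
    module
  have hCE : ∀ k, consensusError (fastMix W η k x) = ∑ i, ‖coef (b i) (u k)‖ ^ 2 := by
    intro k
    rw [sum_norm_coef_sq, consensusError, hW.average_fastMix]
    rfl
  have h0 : consensusError x = ∑ i, ‖coef (b i) (u 0)‖ ^ 2 := by
    rw [← hCE 0, fastMix_zero]
  rw [h0, hCE K, Finset.mul_sum]
  refine Finset.sum_le_sum fun i _ => ?_
  rcases hcase i with hi | hi
  -- Along a constant eigenvector the coefficient is a multiple of the sum of the centred rows,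
  -- hence zero.
  · obtain ⟨κ, hκ⟩ := hW.eigenvectorBasis_const hi
    have hz : coef (b i) (u K) = 0 := by
      simp only [coef, hb, hκ, ← Finset.smul_sum]
      have := sum_sub_average hm0 (fastMix W η K x)
      rw [hW.average_fastMix] at this
      simp only [hu, Pi.sub_apply]
      rw [this, smul_zero]
    rw [hz]
    simp
  · have hi0 := hW.eigenvalues_nonneg i
    set l := hW.isHermitian.eigenvalues i
    have hr := norm_sq_le_of_two_step_recurrence (a := (1 + η) * l) (η := η)
      (u := fun k => coef (b i) (u k)) rfl (fun k => by
        rw [hrec, coef_sub, coef_smul, coef_smul, coef_gossip hW.symm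
          (hW.sum_mul_eigenvectorBasis i), smul_smul]) K
    have hsq : 0 < 1 - lam ^ 2 := by nlinarith
    obtain ⟨hp, hq⟩ := mixWeight_ratio (s := √(1 - lam ^ 2)) (lam := l) (Real.sqrt_pos.2 hsq) hi0 (by linarith)
      (by rw [Real.sq_sqrt hsq.le]; nlinarith)
    change 0 < η - ((1 + η) * l) ^ 2 / 4 at hp
    change 1 + η - (1 + η) * l ≤ 4 * (η - ((1 + η) * l) ^ 2 / 4) at hq
    have hη0 : 0 ≤ η := by rw [hη, mixWeight]; positivity
    refine le_of_mul_le_mul_left (hr.trans ?_) hp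
    calc η ^ K * ((1 + η - (1 + η) * l) * ‖coef (b i) (u 0)‖ ^ 2)
        ≤ 1 / 2 ^ 15 * (4 * (η - ((1 + η) * l) ^ 2 / 4) * ‖coef (b i) (u 0)‖ ^ 2) := by
          have hl : 0 ≤ 1 + η - (1 + η) * l := by nlinarith
          gcongr
      -- The factor 4 lost in `mixWeight_ratio` costs two of the fifteen halvings.
      _ = 1 / 2 ^ 13 * ((η - ((1 + η) * l) ^ 2 / 4) * ‖coef (b i) (u 0)‖ ^ 2) := by ring
      _ ≤ 1 / 100 * ((η - ((1 + η) * l) ^ 2 / 4) * ‖coef (b i) (u 0)‖ ^ 2) := by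
          gcongr
          norm_num
      _ = _ := by ring

end Spectrum

/-! ### One inexact accelerated proximal step -/

lemma mul_objective (hm : 0 < m) (f : Fin m → Vec d → ℝ) (g : Vec d → ℝ) (x : Vec d) :
    m * objective f g x = ∑ i, f i x + m * g x := by
  have : (m : ℝ) ≠ 0 := by positivity
  unfold objective
  field_simp

/-- The accelerated descent estimate for the smooth part, with local gradients taken at `x i`. -/
lemma sum_smooth_le (hm : 0 < m) {L τ : ℝ} (hL : 0 < L) (hτ0 : 0 ≤ τ) (hτ1 : τ ≤ 1)
    {f : Fin m → Vec d → ℝ} (hf : ∀ i, IsConvexSmooth L (f i)) (xstar y z z' : Vec d)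
    (x : Rows m d) (hx : average x = τ • z + (1 - τ) • y) :
    ∑ i, f i (τ • z' + (1 - τ) • y) ≤ (1 - τ) * ∑ i, f i y + τ * ∑ i, f i xstar
      - (1 - τ) * (1 / (2 * L) * ∑ i, ‖gradient (f i) y - gradient (f i) (x i)‖ ^ 2)
      + τ * (m * inner ℝ (average fun i => gradient (f i) (x i)) (z' - xstar))
      + L / 2 * (consensusError x + m * (τ ^ 2 * ‖z' - z‖ ^ 2)) := by
  set w := τ • z' + (1 - τ) • y with hw
  have h : ∀ i, f i w ≤ (1 - τ) * f i y + τ * f i xstar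
      - (1 - τ) * (1 / (2 * L) * ‖gradient (f i) y - gradient (f i) (x i)‖ ^ 2)
      + τ * inner ℝ (gradient (f i) (x i)) (z' - xstar) + L / 2 * ‖x i - w‖ ^ 2 := by
    intro i
    -- Smoothness at `w`, against lower bounds at `y` with weight `1 - τ` and at `xstar` with weight
    -- `τ`. Only the bound at `y` keeps its gradient-difference term, which later pays for gradient
    -- tracking.
    have h1 := (hf i).upper (x i) w
    have h2 := mul_le_mul_of_nonneg_left
      ((hf i).add_norm_gradient_sub_sq_le hL (x i) y) (sub_nonneg.2 hτ1)
    have h3 := mul_le_mul_of_nonneg_left ((hf i).lower (x i) xstar) hτ0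
    have e : inner ℝ (gradient (f i) (x i)) (w - x i)
        = (1 - τ) * inner ℝ (gradient (f i) (x i)) (y - x i)
          + τ * inner ℝ (gradient (f i) (x i)) (xstar - x i)
          + τ * inner ℝ (gradient (f i) (x i)) (z' - xstar) := by
      rw [← inner_smul_right, ← inner_smul_right, ← inner_smul_right, ← inner_add_right,
        ← inner_add_right, hw]
      congr 1
      module
    rw [e] at h1
    linarith
  have hs := Finset.sum_le_sum fun i (_ : i ∈ Finset.univ) => h i
  simp only [Finset.sum_add_distrib, Finset.sum_sub_distrib, ← Finset.mul_sum, ← sum_inner] at hs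
  rw [sum_eq_smul_average hm (fun i => gradient (f i) (x i)), inner_smul_left] at hs
  have hd : ∑ i, ‖x i - w‖ ^ 2 = consensusError x + m * (τ ^ 2 * ‖z' - z‖ ^ 2) := by
    have := sqDist_eq hm x w
    rw [sqDist] at this
    rw [this, hx, hw, add_sub_add_right_eq_sub, ← smul_sub, norm_smul, mul_pow,
      Real.norm_eq_abs, sq_abs, norm_sub_rev]
  rw [hd] at hs
  simpa using hs

/-- The estimate for one round of local proximal steps. -/
lemma sum_prox_le (hm : 0 < m) {γ μ : ℝ} (hγ : 0 ≤ γ) (hμ : 0 ≤ μ) {g : Vec d → ℝ}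
    (hg : StrongConvexOn Set.univ μ g) (xstar : Vec d) {z s p : Rows m d}
    (hp : ∀ i, IsProx γ g (z i - γ • s i) (p i)) :
    2 * γ * (m * (g (average p) - g xstar))
      + 2 * γ * (m * inner ℝ (average s) (average p - xstar))
      + (1 + μ * γ) * sqDist p xstar
    ≤ sqDist z xstar - m * ‖average p - average z‖ ^ 2 + 2 * (γ ^ 2 * consensusError s)
      + 1 / 2 * consensusError p := by
  have hconv : ConvexOn ℝ Set.univ g := hg.convexOn fun r => by positivity
  have h := Finset.sum_le_sum fun i (_ : i ∈ Finset.univ) => (hp i).le hγ hg xstar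
  simp only [Finset.sum_add_distrib, Finset.sum_sub_distrib, ← Finset.mul_sum] at h
  rw [sum_inner_eq hm] at h
  have hJ := mul_le_mul_of_nonneg_left (mul_apply_average_le hm hconv p)
    (by positivity : 0 ≤ 2 * γ)
  have hA := mul_norm_average_sub_sq_le hm p z
  -- Young's inequality: half of the consensus error of `p` is spent here, so half remains available
  -- in `descent`.
  have hY : -(2 * (γ ^ 2 * consensusError s) + 1 / 2 * consensusError p)
      ≤ 2 * γ * ∑ i, inner ℝ (s i - average s) (p i - average p) := by
    unfold consensusError sqDist
    rw [Finset.mul_sum, Finset.mul_sum, Finset.mul_sum, Finset.mul_sum,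
      ← Finset.sum_add_distrib, ← Finset.sum_neg_distrib]
    refine Finset.sum_le_sum fun i _ => ?_
    have h1 := sq_nonneg ‖(2 * γ) • (s i - average s) + (p i - average p)‖
    rw [norm_add_sq_real, inner_smul_left, norm_smul, mul_pow, Real.norm_eq_abs, sq_abs] at h1
    simp only [conj_trivial] at h1
    nlinarith
  simp only [Finset.sum_const, Finset.card_univ, Fintype.card_fin, nsmul_eq_mul] at h
  unfold sqDist at *
  linarith

/-- One step of inexact accelerated proximal gradient descent. -/
lemma descent (hm : 0 < m) {L μ γ : ℝ} (hL : 0 < L) (hμ : 0 < μ) (hγ : 0 < γ)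
    (hLγ : 400 * (L * μ * γ ^ 2) = 1) (hτ1 : μ * γ ≤ 1)
    {f : Fin m → Vec d → ℝ} (hf : ∀ i, IsConvexSmooth L (f i)) {g : Vec d → ℝ}
    (hg : StrongConvexOn Set.univ μ g) (xstar : Vec d) {x y z s p z' y' : Rows m d}
    (hx : x = (μ * γ) • z + (1 - μ * γ) • y)
    (hs : average s = average fun i => gradient (f i) (x i))
    (hp : ∀ i, IsProx γ g (z i - γ • s i) (p i)) (hz : average z' = average p)
    (hy : average y' = (μ * γ) • average z' + (1 - μ * γ) • average y) :
    2 * m / μ * (objective f g (average y') - objective f g xstar)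
      + (1 + μ * γ) * sqDist z' xstar
    ≤ (1 - μ * γ) * (2 * m / μ * (objective f g (average y) - objective f g xstar))
      + sqDist z xstar - 399 / 400 * (m * ‖average z' - average z‖ ^ 2)
      - (1 / 2 + μ * γ) * consensusError p + (1 + μ * γ) * consensusError z'
      + 2 * (γ ^ 2 * consensusError s) + L / μ * consensusError x
      - 400 * (1 - μ * γ)
        * (γ ^ 2 * ∑ i, ‖gradient (f i) (average y) - gradient (f i) (x i)‖ ^ 2) := by
  set τ := μ * γ with hτ
  have hτ0 : 0 ≤ τ := by positivity
  have hm' : (0 : ℝ) < m := by exact_mod_cast hm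
  have h1 := sum_smooth_le hm hL hτ0 hτ1 hf xstar (average y) (average z) (average z') x
    (by rw [hx, average_add, average_smul, average_smul])
  have h2 := sum_prox_le hm hγ.le hμ.le hg xstar hp
  rw [← hs] at h1
  rw [← hy] at h1
  rw [← hz] at h2
  have hconv : ConvexOn ℝ Set.univ g := hg.convexOn fun r => by positivity
  have h3 : g (average y') ≤ τ * g (average z') + (1 - τ) * g (average y) := by
    rw [hy]
    exact hconv.2 (Set.mem_univ _) (Set.mem_univ _) hτ0 (sub_nonneg.2 hτ1) (by ring)
  have h3' := mul_le_mul_of_nonneg_left h3 hm'.le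
  have o : ∀ v, 2 * m / μ * (objective f g v - objective f g xstar)
      = 2 / μ * ((∑ i, f i v + m * g v) - (∑ i, f i xstar + m * g xstar)) := by
    intro v
    rw [← mul_objective hm, ← mul_objective hm]
    ring
  rw [o, o]
  have h4 := mul_le_mul_of_nonneg_left (add_le_add h1 h3') (by positivity : 0 ≤ 2 / μ)
  have hz1 := sqDist_eq hm z' xstar
  have hz2 := sqDist_eq hm p xstar
  rw [← hz] at hz2
  -- Mixing `p` into `z'` keeps the average, so the two distances differ only by consensus errors.
  have hN : (1 + τ) * sqDist z' xstar
      = (1 + τ) * sqDist p xstar - (1 + τ) * consensusError p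
        + (1 + τ) * consensusError z' := by
    rw [hz1, hz2]
    ring
  have e1 : 2 / μ * τ = 2 * γ := by
    rw [hτ]; field_simp
  have e2 : 2 / μ * (1 / (2 * L)) = 400 * γ ^ 2 := by
    field_simp
    linarith
  have e3 : 2 / μ * (L / 2) = L / μ := by field_simp
  -- The smoothness cost takes `1 / 400` of the displacement term of the prox step, leaving `399 /
  -- 400`.
  have e4 : L / μ * τ ^ 2 = 1 / 400 := by
    rw [hτ]
    field_simp
    linarith
  set I : ℝ := inner ℝ (average s) (average z' - xstar)
  set D := ∑ i, ‖gradient (f i) (average y) - gradient (f i) (x i)‖ ^ 2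
  set q := ‖average z' - average z‖ ^ 2
  have key : 2 / μ * ((1 - τ) * ∑ i, f i (average y) + τ * ∑ i, f i xstar
      - (1 - τ) * (1 / (2 * L) * D) + τ * (m * I)
      + L / 2 * (consensusError x + m * (τ ^ 2 * q))
      + m * (τ * g (average z') + (1 - τ) * g (average y)))
      = (1 - τ) * (2 / μ * ((∑ i, f i (average y) + m * g (average y))
          - (∑ i, f i xstar + m * g xstar)))
        + 2 / μ * (∑ i, f i xstar + m * g xstar)
        + (2 / μ * τ) * (m * (g (average z') - g xstar) + m * I)
        - (1 - τ) * ((2 / μ * (1 / (2 * L))) * D)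
        + (2 / μ * (L / 2)) * consensusError x
        + ((2 / μ * (L / 2)) * τ ^ 2) * (m * q) := by ring
  rw [key, e1, e2, e3, e4] at h4
  linarith

/-! ### The Lyapunov function and its contraction -/

/-- Here `δ` is the gap, `N` the distance, `S X Y Z` are the scaled consensus errors, `R` is the
scaled distance between the averages of `x` and `y`, `P` the error before mixing and `D` the scaled
gradient differences. The factor `1 + τ` on `N` is built into the descent, `(1 + τ) * (1 - τ) ≤ 1`
handles `δ`, and the remaining terms shrink to `9 / 10`, which beats `1 / (1 + τ)` for `τ ≤ 1 / 20`.
-/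
lemma lyapunov_contraction_arith {τ δ δ' N N' S S' X X' Y Y' Z Z' R R' P D : ℝ} (hτ0 : 0 ≤ τ)
    (hτ : τ ≤ 1 / 20) (hδ : 0 ≤ δ) (hS : 0 ≤ S) (hX : 0 ≤ X) (hY : 0 ≤ Y)
    (hZ : 0 ≤ Z) (hZ' : 0 ≤ Z') (hR : 0 ≤ R) (hR' : 0 ≤ R') (hP : 0 ≤ P) (hD : 0 ≤ D)
    (h : δ' + (1 + τ) * N' ≤ (1 - τ) * δ + N - 399 / 400 * R' - (1 / 2 + τ) * P
      + (1 + τ) * Z' + 2 * S' + 1 / 400 * X' - 400 * (1 - τ) * D)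
    (hSS : S' ≤ 3 / 100 * (S + D + (R + X) / 160000)) (hXX : X' ≤ 2 * Z + 2 * Y)
    (hZZ : Z' ≤ 1 / 100 * P) (hYY : Y' ≤ 1 / 100 * (2 * Z' + 2 * Y)) :
    (1 + τ) * (δ' + (1 + τ) * N' + S' + Y' + Z' + R' / 2 + X' / 400)
      ≤ δ + (1 + τ) * N + S + Y + Z + R / 2 + X / 400 := by
  have h1 : 0 ≤ τ * P := by positivity
  have h2 : τ * Z' ≤ 1 / 20 * Z' := by gcongr
  have h3 : τ * D ≤ 1 / 20 * D := by gcongr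
  have h4 : δ' + (1 + τ) * N' + S' + Y' + Z' + R' / 2 + X' / 400
      ≤ (1 - τ) * δ + N + 9 / 10 * (S + Y + Z + R / 2 + X / 400) := by linarith
  have h5 := mul_le_mul_of_nonneg_left h4 (by linarith : 0 ≤ 1 + τ)
  have h6 : 0 ≤ τ ^ 2 * δ := by positivity
  have h7 : τ * (S + Y + Z + R / 2 + X / 400) ≤ 1 / 20 * (S + Y + Z + R / 2 + X / 400) := by
    gcongr
  have h8 : 0 ≤ S + Y + Z + R / 2 + X / 400 := by positivity
  linarith

/-- The Lyapunov function of the algorithm. -/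
noncomputable def potential (γ τ μ : ℝ) (f : Fin m → Vec d → ℝ) (g : Vec d → ℝ) (xstar : Vec d)
    (S : State m d) : ℝ :=
  2 * m / μ * (objective f g (average S.y) - objective f g xstar)
    + (1 + τ) * sqDist S.z xstar + γ ^ 2 * consensusError S.s
    + consensusError S.y / τ ^ 2 + consensusError S.z
    + m * ‖average S.x - average S.y‖ ^ 2 / τ ^ 2 / 2 + consensusError S.x / τ ^ 2 / 400

/-- Gradient tracking: the average of `s` is the average of the current local gradients. -/
structure Tracks (f : Fin m → Vec d → ℝ) (S : State m d) : Prop where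
  grad_eq : S.grad = fun i => gradient (f i) (S.x i)
  average_eq : average S.s = average S.grad

lemma tracks_initState (f : Fin m → Vec d → ℝ) (x₁ : Vec d) : Tracks f (initState f x₁) :=
  ⟨rfl, rfl⟩

lemma Tracks.step {f : Fin m → Vec d → ℝ} {S : State m d} (hS : Tracks f S)
    {W : Matrix (Fin m) (Fin m) ℝ} {η : ℝ} {K : ℕ}
    (havg : ∀ x : Rows m d, average (fastMix W η K x) = average x) (γ τ : ℝ)
    (g : Vec d → ℝ) : Tracks f (step W η K γ τ f g S) := by
  refine ⟨rfl, ?_⟩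
  simp only [ODAPG.step]
  rw [havg, average_sub, average_add, hS.average_eq]
  abel

theorem potential_step_le (hm : 0 < m) {L μ γ : ℝ} (hL : 0 < L) (hμ : 0 < μ) (hγ : 0 < γ)
    (hLγ : 400 * (L * μ * γ ^ 2) = 1) (hτ : μ * γ ≤ 1 / 20)
    {f : Fin m → Vec d → ℝ} (hf : ∀ i, IsConvexSmooth L (f i)) {g : Vec d → ℝ}
    (hg : StrongConvexOn Set.univ μ g) {xstar : Vec d}
    (hstar : IsMinOn (objective f g) Set.univ xstar)
    {W : Matrix (Fin m) (Fin m) ℝ} {η : ℝ} {K : ℕ}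
    (havg : ∀ x : Rows m d, average (fastMix W η K x) = average x)
    (hmix : ∀ x : Rows m d, consensusError (fastMix W η K x) ≤ 1 / 100 * consensusError x)
    {S : State m d} (hS : Tracks f S) :
    (1 + μ * γ) * potential γ (μ * γ) μ f g xstar (step W η K γ (μ * γ) f g S)
      ≤ potential γ (μ * γ) μ f g xstar S := by
  have hS' := hS.step havg γ (μ * γ) g
  set S' := step W η K γ (μ * γ) f g S with hS'_def
  set p : Rows m d := fun i => prox γ g (S.z i - γ • S'.s i) with hp
  have hx : S'.x = (μ * γ) • S.z + (1 - μ * γ) • S.y := rfl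
  have hs : S'.s = fastMix W η K (S.s + S'.grad - S.grad) := rfl
  have hz : S'.z = fastMix W η K p := rfl
  have hy : S'.y = fastMix W η K ((μ * γ) • S'.z + (1 - μ * γ) • S.y) := rfl
  have hya : average S'.y = (μ * γ) • average S'.z + (1 - μ * γ) • average S.y := by
    rw [hy, havg, average_add, average_smul, average_smul]
  have hxa : average S'.x = (μ * γ) • average S.z + (1 - μ * γ) • average S.y := by
    rw [hx, average_add, average_smul, average_smul]
  have hdesc := descent hm hL hμ hγ hLγ (by linarith) hf hg xstar hx
    (by rw [hS'.average_eq, hS'.grad_eq]) (fun i => isProx_prox hγ.le hμ.le hg _)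
    (show average S'.z = average p by rw [hz, havg]) hya
  set τ := μ * γ with hτ_def
  have hτ0 : 0 < τ := by positivity
  have e4 : L / μ = 1 / 400 * (1 / τ ^ 2) := by
    rw [hτ_def]
    field_simp
    linarith
  -- The averages of the new `x` and `y` differ by `τ` times the displacement of `z`, so the
  -- negative term of `descent` controls the next `R`.
  have hR' : m * ‖average S'.z - average S.z‖ ^ 2
      = m * ‖average S'.x - average S'.y‖ ^ 2 / τ ^ 2 := by
    rw [hya, hxa, add_sub_add_right_eq_sub, ← smul_sub, norm_smul, mul_pow, Real.norm_eq_abs,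
      sq_abs, norm_sub_rev]
    field_simp
  rw [e4, hR', show 1 / 400 * (1 / τ ^ 2) * consensusError S'.x
    = 1 / 400 * (consensusError S'.x / τ ^ 2) by ring] at hdesc
  have hδ : 0 ≤ 2 * m / μ * (objective f g (average S.y) - objective f g xstar) :=
    mul_nonneg (by positivity) (sub_nonneg.2 (hstar (Set.mem_univ _)))
  have hnn := fun x : Rows m d => consensusError_nonneg x
  have hτ1 : 0 ≤ 1 - τ := by linarith
  have hτ2 : (1 - τ) ^ 2 ≤ 1 := by nlinarith
  have hsum : ∀ z y : Rows m d, consensusError (τ • z + (1 - τ) • y) / τ ^ 2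
      ≤ 2 * consensusError z + 2 * (consensusError y / τ ^ 2) := by
    intro z y
    have h := consensusError_add_le (τ • z) ((1 - τ) • y)
    rw [consensusError_smul, consensusError_smul] at h
    rw [div_le_iff₀ (by positivity)]
    have e : (2 * consensusError z + 2 * (consensusError y / τ ^ 2)) * τ ^ 2
        = 2 * (τ ^ 2 * consensusError z) + 2 * consensusError y := by
      field_simp
    have h1 := mul_le_mul_of_nonneg_right hτ2 (hnn y)
    rw [e]
    linarith
  refine lyapunov_contraction_arith hτ0.le hτ hδ (mul_nonneg (by positivity) (hnn _))
    (div_nonneg (hnn _) (by positivity)) (div_nonneg (hnn _) (by positivity)) (hnn _) (hnn _)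
    (by positivity) (by positivity) (hnn _)
    (mul_nonneg (by positivity) (Finset.sum_nonneg fun _ _ => by positivity)) hdesc ?_ ?_ ?_ ?_
  -- The tracker's gradient change is split at the average of the old `y`: the new half is the sum
  -- bounded by `D`, the old half is bounded by Lipschitz continuity.
  · set Gy : Rows m d := fun i => gradient (f i) (average S.y) with hGy
    have h1 : consensusError S'.s ≤ 1 / 100 * (3 * (consensusError S.s
        + consensusError (S'.grad - Gy) + consensusError (Gy - S.grad))) := by
      rw [hs]
      refine (hmix _).trans ?_
      gcongr
      rw [show S.s + S'.grad - S.grad = S.s + (S'.grad - Gy) + (Gy - S.grad) by abel]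
      exact consensusError_add_add_le _ _ _
    have h2 : consensusError (S'.grad - Gy)
        ≤ ∑ i, ‖gradient (f i) (average S.y) - gradient (f i) (S'.x i)‖ ^ 2 := by
      refine (consensusError_le hm _ 0).trans_eq ?_
      rw [hS'.grad_eq]
      exact Finset.sum_congr rfl fun i _ => by rw [sub_zero, Pi.sub_apply, norm_sub_rev]
    have h3 : consensusError (Gy - S.grad)
        ≤ L ^ 2 * (consensusError S.x + m * ‖average S.x - average S.y‖ ^ 2) := by
      refine (consensusError_le hm _ 0).trans ?_
      rw [← sqDist_eq hm, hS.grad_eq, sqDist, sqDist, Finset.mul_sum]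
      refine Finset.sum_le_sum fun i _ => ?_
      rw [sub_zero, Pi.sub_apply, norm_sub_rev (S.x i)]
      exact (hf i).norm_gradient_sub_sq_le hL _ _
    have e : γ ^ 2 * L ^ 2 = 1 / τ ^ 2 / 160000 := by
      rw [hτ_def]
      field_simp
      have : (400 * (L * μ * γ ^ 2)) ^ 2 = 1 := by rw [hLγ, one_pow]
      linarith
    have h4 : consensusError S'.s ≤ 1 / 100 * (3 * (consensusError S.s
        + ∑ i, ‖gradient (f i) (average S.y) - gradient (f i) (S'.x i)‖ ^ 2
        + L ^ 2 * (consensusError S.x + m * ‖average S.x - average S.y‖ ^ 2))) :=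
      h1.trans (by gcongr)
    refine (mul_le_mul_of_nonneg_left h4 (sq_nonneg γ)).trans_eq ?_
    rw [show ∀ a b c : ℝ, γ ^ 2 * (1 / 100 * (3 * (a + b + L ^ 2 * c)))
      = 3 / 100 * (γ ^ 2 * a + γ ^ 2 * b + (γ ^ 2 * L ^ 2) * c) by intros; ring, e]
    ring
  · rw [hx]
    exact hsum _ _
  · rw [hz]
    exact hmix _
  · rw [hy]
    refine (div_le_div_of_nonneg_right (hmix _) (by positivity)).trans ?_
    rw [mul_div_assoc]
    gcongr
    exact hsum _ _

/-! ### Parameters -/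

section Parameters

variable {L μ : ℝ}

lemma stepSize_pos (hL : 0 < L) (hμ : 0 < μ) : 0 < stepSize L μ := by
  unfold stepSize
  positivity

lemma mul_stepSize_sq (hL : 0 < L) (hμ : 0 < μ) : 400 * (L * μ * stepSize L μ ^ 2) = 1 := by
  have h : 0 < L * μ := by positivity
  rw [stepSize, div_pow, mul_pow, Real.sq_sqrt h.le]
  field_simp
  norm_num

lemma coupling_mul_sqrt (hL : 0 < L) (hμ : 0 < μ) : coupling L μ * (20 * √(L / μ)) = 1 := by
  rw [coupling, stepSize, Real.sqrt_div hL.le, Real.sqrt_mul hL.le]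
  have h : √μ ^ 2 = μ := Real.sq_sqrt hμ.le
  have h1 : 0 < √μ := Real.sqrt_pos.2 hμ
  have h2 : 0 < √L := Real.sqrt_pos.2 hL
  field_simp
  linarith

lemma coupling_pos (hL : 0 < L) (hμ : 0 < μ) : 0 < coupling L μ :=
  mul_pos hμ (stepSize_pos hL hμ)

lemma one_le_sqrt_div (hμ : 0 < μ) (hμL : μ ≤ L) : 1 ≤ √(L / μ) :=
  Real.one_le_sqrt.2 ((one_le_div hμ).2 hμL)

lemma coupling_le (hμ : 0 < μ) (hμL : μ ≤ L) : coupling L μ ≤ 1 / 20 := by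
  have hL := hμ.trans_le hμL
  have h1 := coupling_mul_sqrt hL hμ
  have h2 := mul_le_mul_of_nonneg_left (one_le_sqrt_div hμ hμL) (coupling_pos hL hμ).le
  linarith

end Parameters

/-! ### Linear rate and complexity count -/

lemma consensusError_const (hm : 0 < m) (v : Vec d) :
    consensusError (fun _ : Fin m => v) = 0 := by
  simp [consensusError, sqDist, average_const hm]

lemma IsWeightMatrix.potential_odapg_le {G : SimpleGraph (Fin m)}
    {W : Matrix (Fin m) (Fin m) ℝ} (hW : IsWeightMatrix G W) (hm : 2 ≤ m) {L μ : ℝ}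
    (hμ : 0 < μ) (hμL : μ ≤ L) {f : Fin m → Vec d → ℝ} (hf : ∀ i, IsConvexSmooth L (f i))
    {g : Vec d → ℝ} (hg : StrongConvexOn Set.univ μ g) (x₁ : Vec d) {xstar : Vec d}
    (hstar : IsMinOn (objective f g) Set.univ xstar) (T : ℕ) :
    (1 + coupling L μ) ^ T * potential (stepSize L μ) (coupling L μ) μ f g xstar
        (odapg W (lambda₂ hW.isHermitian hm) L μ f g x₁ T)
      ≤ potential (stepSize L μ) (coupling L μ) μ f g xstar (initState f x₁) := by
  have hL := hμ.trans_le hμL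
  have hτ := coupling_pos hL hμ
  have key : Tracks f (odapg W (lambda₂ hW.isHermitian hm) L μ f g x₁ T) ∧
      (1 + coupling L μ) ^ T * potential (stepSize L μ) (coupling L μ) μ f g xstar
        (odapg W (lambda₂ hW.isHermitian hm) L μ f g x₁ T)
      ≤ potential (stepSize L μ) (coupling L μ) μ f g xstar (initState f x₁) := by
    induction T with
    | zero =>
      refine ⟨tracks_initState f x₁, ?_⟩
      rw [pow_zero, one_mul]
      rfl
    | succ T ih =>
      obtain ⟨htr, ih⟩ := ih
      unfold odapg at *
      rw [Function.iterate_succ_apply']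
      refine ⟨htr.step (hW.average_fastMix _ _) _ _ _, le_trans ?_ ih⟩
      rw [pow_succ, mul_assoc]
      gcongr
      exact potential_step_le (by omega) hL hμ (stepSize_pos hL hμ) (mul_stepSize_sq hL hμ)
        (coupling_le hμ hμL) hf hg hstar (hW.average_fastMix _ _)
        (hW.consensusError_fastMix_le hm) htr
  exact key.2

lemma objective_sub_nonneg {f : Fin m → Vec d → ℝ} {g : Vec d → ℝ} {xstar : Vec d} {μ : ℝ}
    (hμ : 0 < μ) (hstar : IsMinOn (objective f g) Set.univ xstar) (y : Vec d) :
    0 ≤ 2 * m / μ * (objective f g y - objective f g xstar) :=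
  mul_nonneg (by positivity) (sub_nonneg.2 (hstar (Set.mem_univ _)))

lemma sqDist_le_potential {γ τ μ : ℝ} (hμ : 0 < μ) (hτ : 0 ≤ τ) {f : Fin m → Vec d → ℝ}
    {g : Vec d → ℝ} {xstar : Vec d} (hstar : IsMinOn (objective f g) Set.univ xstar)
    (S : State m d) : sqDist S.z xstar ≤ potential γ τ μ f g xstar S := by
  have h0 := objective_sub_nonneg hμ hstar (average S.y)
  have h1 := mul_nonneg hτ (sqDist_nonneg S.z xstar)
  have h2 := mul_nonneg (sq_nonneg γ) (consensusError_nonneg S.s)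
  have h3 := div_nonneg (consensusError_nonneg S.y) (sq_nonneg τ)
  have h4 := consensusError_nonneg S.z
  have h5 : 0 ≤ m * ‖average S.x - average S.y‖ ^ 2 / τ ^ 2 / 2 := by positivity
  have h6 := div_nonneg (consensusError_nonneg S.x) (sq_nonneg τ)
  unfold potential
  linarith

/-- The common starting point removes every consensus error except that of `s`. -/
lemma initialGap_eq (hm : 0 < m) {L μ : ℝ} (hL : 0 < L) (hμ : 0 < μ)
    (f : Fin m → Vec d → ℝ) (g : Vec d → ℝ) (x₁ xstar : Vec d) :
    initialGap L μ f g x₁ xstar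
      = 2 * m / μ * (objective f g x₁ - objective f g xstar)
        + sqDist (initState f x₁).z xstar
        + 15 / 7 * (stepSize L μ ^ 2 * consensusError (initState f x₁).s) := by
  have h := mul_stepSize_sq hL hμ
  have e : L / μ * coupling L μ ^ 2 = 1 / 400 := by
    rw [coupling]
    field_simp
    linarith
  unfold initialGap
  simp only [initState, average_const hm, consensusError_const hm]
  rw [show ∀ c : ℝ, 6 * 20 ^ 2 * L / μ * (0 + 64 * 0 + 9 * coupling L μ ^ 2 / 32 * 0
      + 5 * coupling L μ ^ 2 / 14 * stepSize L μ ^ 2 * c)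
    = 6000 / 7 * (L / μ * coupling L μ ^ 2) * (stepSize L μ ^ 2 * c) by intro c; ring, e]
  ring

lemma initialGap_nonneg (hm : 0 < m) {L μ : ℝ} (hL : 0 < L) (hμ : 0 < μ)
    {f : Fin m → Vec d → ℝ} {g : Vec d → ℝ} (x₁ : Vec d) {xstar : Vec d}
    (hstar : IsMinOn (objective f g) Set.univ xstar) : 0 ≤ initialGap L μ f g x₁ xstar := by
  rw [initialGap_eq hm hL hμ]
  have h0 := objective_sub_nonneg hμ hstar x₁
  have h1 := sqDist_nonneg (initState f x₁).z xstar
  have h2 := mul_nonneg (sq_nonneg (stepSize L μ)) (consensusError_nonneg (initState f x₁).s)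
  linarith

lemma potential_initState_le (hm : 0 < m) {L μ : ℝ} (hμ : 0 < μ) (hμL : μ ≤ L)
    {f : Fin m → Vec d → ℝ} {g : Vec d → ℝ} (x₁ : Vec d) {xstar : Vec d}
    (hstar : IsMinOn (objective f g) Set.univ xstar) :
    potential (stepSize L μ) (coupling L μ) μ f g xstar (initState f x₁)
      ≤ 2 * initialGap L μ f g x₁ xstar := by
  have hL := hμ.trans_le hμL
  rw [initialGap_eq hm hL hμ]
  have h0 := objective_sub_nonneg hμ hstar x₁
  have h1 := sqDist_nonneg (initState f x₁).z xstar
  have h2 := mul_nonneg (sq_nonneg (stepSize L μ)) (consensusError_nonneg (initState f x₁).s)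
  have h3 := mul_le_mul_of_nonneg_right (coupling_le hμ hμL) h1
  have e : potential (stepSize L μ) (coupling L μ) μ f g xstar (initState f x₁)
      = 2 * m / μ * (objective f g x₁ - objective f g xstar)
        + (1 + coupling L μ) * sqDist (initState f x₁).z xstar
        + stepSize L μ ^ 2 * consensusError (initState f x₁).s := by
    unfold potential
    simp [initState, average_const hm, consensusError_const hm]
  rw [e]
  linarith

lemma gradCalls_odapg (W : Matrix (Fin m) (Fin m) ℝ) (lam L μ : ℝ) (f : Fin m → Vec d → ℝ)
    (g : Vec d → ℝ) (x₁ : Vec d) (T : ℕ) :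
    (odapg W lam L μ f g x₁ T).gradCalls = T + 1 := by
  induction T with
  | zero => rfl
  | succ T ih =>
    unfold odapg at *
    rw [Function.iterate_succ_apply', step, ih]

lemma rounds_odapg (W : Matrix (Fin m) (Fin m) ℝ) (lam L μ : ℝ) (f : Fin m → Vec d → ℝ)
    (g : Vec d → ℝ) (x₁ : Vec d) (T : ℕ) :
    (odapg W lam L μ f g x₁ T).rounds = 3 * mixLength lam * T := by
  induction T with
  | zero => rfl
  | succ T ih =>
    unfold odapg at *
    rw [Function.iterate_succ_apply', step]
    simp only [ih, rounds_mixRun]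
    ring

/-- Follows from `exp (-τ / 2) ≥ 1 - τ / 2` and `(1 + τ) * (1 - τ / 2) ≥ 1`. -/
lemma exp_half_le {τ : ℝ} (h0 : 0 ≤ τ) (h1 : τ ≤ 1) : Real.exp (τ / 2) ≤ 1 + τ := by
  have h := Real.add_one_le_exp (-(τ / 2))
  have h2 : Real.exp (τ / 2) * Real.exp (-(τ / 2)) = 1 := by
    rw [← Real.exp_add, add_neg_cancel, Real.exp_zero]
  have h3 := mul_le_mul_of_nonneg_left h (Real.exp_pos (τ / 2)).le
  nlinarith [Real.exp_pos (τ / 2)]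

lemma FindsWithin.mono {run : ℕ → State m d} {xstar : Vec d} {ε A B A' B' : ℝ}
    (h : FindsWithin run xstar ε A B) (hA : A ≤ A') (hB : B ≤ B') :
    FindsWithin run xstar ε A' B' := by
  obtain ⟨T, h1, h2, h3⟩ := h
  exact ⟨T, h1, h2.trans hA, h3.trans hB⟩

lemma mixLength_le {lam : ℝ} (h0 : 0 ≤ lam) (h1 : lam < 1) :
    (mixLength lam : ℝ) ≤ 16 / √(1 - lam) := by
  have hr : 0 < √(1 - lam) := Real.sqrt_pos.2 (by linarith)
  have hr1 : √(1 - lam) ≤ 1 := Real.sqrt_le_one.2 (by linarith)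
  have h := (Nat.ceil_lt_add_one (by positivity : 0 ≤ 15 / √(1 - lam))).le
  have h2 : 1 ≤ 1 / √(1 - lam) := by rwa [le_div_iff₀ hr, one_mul]
  have e : 16 / √(1 - lam) = 15 / √(1 - lam) + 1 / √(1 - lam) := by ring
  rw [mixLength, e]
  linarith

theorem IsWeightMatrix.findsWithin_odapg {G : SimpleGraph (Fin m)}
    {W : Matrix (Fin m) (Fin m) ℝ} (hW : IsWeightMatrix G W) (hm : 2 ≤ m) {L μ : ℝ}
    (hμ : 0 < μ) (hμL : μ ≤ L) {f : Fin m → Vec d → ℝ} (hf : ∀ i, IsConvexSmooth L (f i))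
    {g : Vec d → ℝ} (hg : StrongConvexOn Set.univ μ g) (x₁ : Vec d) {xstar : Vec d}
    (hstar : IsMinOn (objective f g) Set.univ xstar) {ε : ℝ} (hε : 0 < ε) :
    FindsWithin (odapg W (lambda₂ hW.isHermitian hm) L μ f g x₁) xstar ε
      (2000 * √(L / μ) * (1 + Real.log (1 + initialGap L μ f g x₁ xstar / ε)))
      (2000 * √(L / (μ * (1 - lambda₂ hW.isHermitian hm))) *
        (1 + Real.log (1 + initialGap L μ f g x₁ xstar / ε))) := by
  have hL := hμ.trans_le hμL
  have hm0 : 0 < m := by omega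
  have hτ0 := coupling_pos hL hμ
  have hτ1 := coupling_le hμ hμL
  have hτs := coupling_mul_sqrt hL hμ
  have hsq := one_le_sqrt_div hμ hμL
  have hgap := initialGap_nonneg hm0 hL hμ x₁ hstar
  have hinit := potential_initState_le hm0 hμ hμL x₁ hstar
  have hpot := hW.potential_odapg_le hm hμ hμL hf hg x₁ hstar
  have hl1 := hW.lambda₂_lt_one hm
  have hK := mixLength_le (hW.lambda₂_nonneg hm) hl1
  set lam := lambda₂ hW.isHermitian hm
  set τ := coupling L μ
  set Δ := initialGap L μ f g x₁ xstar
  set Λ := 1 + Real.log (1 + Δ / ε) with hΛ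
  have hq : 0 ≤ Δ / ε := by positivity
  have hΛ1 : 1 ≤ Λ := by
    have := Real.log_nonneg (by linarith : 1 ≤ 1 + Δ / ε)
    linarith
  have hinv : 2 / τ * Λ = 40 * √(L / μ) * Λ := by
    congr 1
    rw [div_eq_iff hτ0.ne']
    linarith
  have hsΛ : 1 ≤ √(L / μ) * Λ := one_le_mul_of_one_le_of_one_le hsq hΛ1
  have hT : (⌈2 / τ * Λ⌉₊ : ℝ) ≤ 41 * (√(L / μ) * Λ) := by
    have := (Nat.ceil_lt_add_one (by positivity : 0 ≤ 2 / τ * Λ)).le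
    rw [hinv] at this
    rw [hinv]
    linarith
  -- This count gives `(1 + τ) ^ T ≥ exp Λ`. The summand `1` in `Λ` supplies a factor `exp 1 ≥ 2`,
  -- which absorbs the factor 2 between potential and initial gap.
  refine ⟨⌈2 / τ * Λ⌉₊, fun T hTT => ?_, ?_, ?_⟩
  · have h1 : 2 / τ * Λ ≤ T := (Nat.le_ceil _).trans (by exact_mod_cast hTT)
    have h2 : Λ ≤ T * (τ / 2) := by
      rw [div_mul_eq_mul_div, div_le_iff₀ hτ0] at h1
      linarith
    have h3 : 2 * (1 + Δ / ε) ≤ (1 + τ) ^ T := by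
      calc 2 * (1 + Δ / ε) ≤ Real.exp 1 * (1 + Δ / ε) := by
            gcongr
            linarith [Real.add_one_le_exp 1]
        _ = Real.exp Λ := by
            rw [hΛ, Real.exp_add, Real.exp_log (by linarith)]
        _ ≤ Real.exp (T * (τ / 2)) := Real.exp_le_exp.2 h2
        _ = Real.exp (τ / 2) ^ T := Real.exp_nat_mul _ _
        _ ≤ (1 + τ) ^ T := by
            gcongr
            exact exp_half_le hτ0.le (by linarith)
    have h4 := sqDist_le_potential (γ := stepSize L μ) hμ hτ0.le hstar (odapg W lam L μ f g x₁ T)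
    have h5 : (1 + τ) ^ T * sqDist (odapg W lam L μ f g x₁ T).z xstar ≤ 2 * Δ :=
      (mul_le_mul_of_nonneg_left h4 (by positivity)).trans ((hpot T).trans hinit)
    have h6 : 2 * Δ ≤ (1 + τ) ^ T * ε := by
      have := mul_le_mul_of_nonneg_right h3 hε.le
      have e : 2 * (1 + Δ / ε) * ε = 2 * ε + 2 * Δ := by field_simp
      linarith
    exact le_of_mul_le_mul_left (h5.trans h6) (by positivity)
  · rw [gradCalls_odapg]
    push_cast
    linarith
  · rw [rounds_odapg]
    push_cast
    rw [← div_div, Real.sqrt_div (by positivity)]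
    have hr : 0 < √(1 - lam) := Real.sqrt_pos.2 (by linarith)
    calc 3 * (mixLength lam : ℝ) * (⌈2 / τ * Λ⌉₊ : ℝ)
        ≤ 3 * (16 / √(1 - lam)) * (41 * (√(L / μ) * Λ)) := by gcongr
      _ = 1968 * (√(L / μ) / √(1 - lam) * Λ) := by ring
      _ ≤ 2000 * (√(L / μ) / √(1 - lam) * Λ) := by
          gcongr
          norm_num
      _ = _ := by ring

/-- For such `ε`, both `1 ≤ log (1 / ε)` and `1 + Δ / ε ≤ (1 / ε) ^ 2`, contributing one and two
logarithms. -/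
lemma one_add_log_le {Δ ε : ℝ} (hΔ : 0 ≤ Δ) (hε : 0 < ε)
    (h : ε ≤ min (Real.exp (-1)) (1 / (1 + Δ))) :
    1 + Real.log (1 + Δ / ε) ≤ 3 * Real.log (1 / ε) := by
  obtain ⟨h1, h2⟩ := le_min_iff.1 h
  have h3 : Real.log ε ≤ -1 := (Real.log_le_iff_le_exp hε).2 h1
  have h4 : 1 + Δ ≤ 1 / ε := by
    rw [le_div_iff₀ (by linarith)] at h2
    rw [le_div_iff₀ hε]
    linarith
  have h5 : 1 ≤ 1 / ε := by linarith
  have h6 : 1 + Δ / ε ≤ (1 / ε) ^ 2 := by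
    have e : Δ / ε = Δ * (1 / ε) := by ring
    rw [e, sq]
    have := mul_le_mul_of_nonneg_right h4 (by positivity : 0 ≤ 1 / ε)
    linarith
  have h7 := Real.log_le_log (by positivity) h6
  rw [Real.log_pow, one_div, Real.log_inv] at h7
  rw [one_div, Real.log_inv]
  push_cast at h7
  linarith

end ODAPG

theorem corollary1 :
    ∃ c : ℝ, 0 < c ∧
      ∀ (m d : ℕ) (hm : 2 ≤ m)
        (G : SimpleGraph (Fin m)) (W : Matrix (Fin m) (Fin m) ℝ)
        (hW : ODAPG.IsWeightMatrix G W)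
        (L μ : ℝ) (_ : 0 < μ) (_ : μ ≤ L)
        (f : Fin m → ODAPG.Vec d → ℝ) (_ : ∀ i, ODAPG.IsConvexSmooth L (f i))
        (g : ODAPG.Vec d → ℝ) (_ : StrongConvexOn Set.univ μ g)
        (x₁ xstar : ODAPG.Vec d) (_ : IsMinOn (ODAPG.objective f g) Set.univ xstar),
        (∀ ε : ℝ, 0 < ε →
          ODAPG.FindsWithin
            (ODAPG.odapg W (ODAPG.lambda₂ hW.isHermitian hm) L μ f g x₁) xstar ε
            (c * √(L / μ) * (1 + Real.log (1 + ODAPG.initialGap L μ f g x₁ xstar / ε)))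
            (c * √(L / (μ * (1 - ODAPG.lambda₂ hW.isHermitian hm))) *
              (1 + Real.log (1 + ODAPG.initialGap L μ f g x₁ xstar / ε)))) ∧
        (∃ ε₀ : ℝ, 0 < ε₀ ∧ ∀ ε : ℝ, 0 < ε → ε ≤ ε₀ →
          ODAPG.FindsWithin
            (ODAPG.odapg W (ODAPG.lambda₂ hW.isHermitian hm) L μ f g x₁) xstar ε
            (c * √(L / μ) * Real.log (1 / ε))
            (c * √(L / (μ * (1 - ODAPG.lambda₂ hW.isHermitian hm))) * Real.log (1 / ε))) := by
  -- The constant 2000 of `findsWithin_odapg`, times 3 from `one_add_log_le`.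
  refine ⟨6000, by norm_num, ?_⟩
  intro m d hm G W hW L μ hμ hμL f hf g hg x₁ xstar hstar
  have hgap := ODAPG.initialGap_nonneg (by omega : 0 < m) (hμ.trans_le hμL) hμ x₁ hstar
  have main := fun (ε : ℝ) (hε : 0 < ε) =>
    hW.findsWithin_odapg hm hμ hμL hf hg x₁ hstar hε
  refine ⟨fun ε hε => ?_, min (Real.exp (-1)) (1 / (1 + ODAPG.initialGap L μ f g x₁ xstar)),
    by positivity, fun ε hε hle => ?_⟩
  · have hlog : 0 ≤ Real.log (1 + ODAPG.initialGap L μ f g x₁ xstar / ε) :=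
      Real.log_nonneg (le_add_of_nonneg_right (by positivity))
    refine (main ε hε).mono ?_ ?_ <;> gcongr <;> norm_num
  · have hlog := ODAPG.one_add_log_le hgap hε hle
    have key : ∀ a : ℝ, 0 ≤ a →
        2000 * a * (1 + Real.log (1 + ODAPG.initialGap L μ f g x₁ xstar / ε))
          ≤ 6000 * a * Real.log (1 / ε) := by
      intro a ha
      have := mul_le_mul_of_nonneg_left hlog (by positivity : 0 ≤ 2000 * a)
      linarith
    exact (main ε hε).mono (key _ (Real.sqrt_nonneg _)) (key _ (Real.sqrt_nonneg _))
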